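/- Corollary 6.4 (norm bound, $(n+1)$-partite case). Let $X$ be a finite pure $n$-dimensional simplicial complex (with the convention $X^{(-1)}=\{\emptyset\}$), let $X^{(k)}$ be its set of $k$-simplices and $\Sigma(k)$ its set of ordered $k$-simplices, and let $m$ be a balanced weight on $X$: a strictly positive function on $\bigcup_{-1\le k\le n}X^{(k)}$ with $\sum_{\sigma\in X^{(k+1)},\,\tau\subset\sigma}m(\sigma)=m(\tau)$ for all $-1\le k\le n-1$ and $\tau\in X^{(k)}$; put $m((v_0,\dots,v_k))=m(\{v_0,\dots,v_k\})$. Let $C^k(X,\mathbb R)$ be the space of antisymmetric functions $\Sigma(k)\to\mathbb R$ with the inner product $\langle\phi,\psi\rangle=\sum_{\tau\in\Sigma(k)}\frac{m(\tau)}{(k+1)!}\phi(\tau)\psi(\tau)$, let $d_k:C^k(X,\mathbb R)\to C^{k+1}(X,\mathbb R)$, $(d_k\phi)((v_0,\dots,v_{k+1}))=\sum_{i=0}^{k+1}(-1)^i\phi((v_0,\dots,\widehat{v_i},\dots,v_{k+1}))$, be the differential, and let $\Delta_k^+=d_k^*d_k$ and $\Delta_k^-=d_{k-1}d_{k-1}^*$.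 For $\tau\in X^{(j)}$, the link $X_\tau=\{\sigma\in X:\sigma\cap\tau=\emptyset,\ \sigma\cup\tau\in X\}$ has dimension $n-j-1$ and carries the weight $m_\tau(\sigma)=m(\tau\cup\sigma)$; $\Delta^+_{\tau,0}$ denotes its operator $\Delta^+_0$. In particular $X_\emptyset=X$. Assume that the $1$-skeletons of all links of $X$ of dimension $>0$ (including $X$ itself) are connected and that $X$ is $(n+1)$-partite: its set of vertices is a disjoint union $S_0\cup\dots\cup S_n$ of sides such that the two ends of every edge lie on different sides. For $0\le j\le n$ let $d_{(k,j)}:C^k(X,\mathbb R)\to C^{k+1}(X,\mathbb R)$ be given by $d_{(k,j)}\phi((v_0,\dots,v_{k+1}))=(-1)^i\phi((v_0,\dots,\widehat{v_i},\dots,v_{k+1}))$ if $v_i\in S_j$, and $=0$ if no $v_i$ is in $S_j$, and let $\Delta^-_{(k,j)}=d_{(k-1,j)}d_{(k-1,j)}^*$. Let $f(x)=2-\frac1x$ and let $f^i$ be its $i$-fold composition ($f^0(x)=x$). Suppose that $\lambda>\frac{n-1}{n}$ and $$\bigcup_{\tau\in X^{(n-2)}}\operatorname{Spec}(\Delta^+_{\tau,0})\setminus\{0\}\subseteq[\lambda,2],$$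 and that $X$ has more than one $n$-simplex or $\lambda\le1$. Then for every $0\le k\le n-1$, with $\mu=f^{\,n-1-k}(\lambda)$ and $\theta=\frac{2+(n-k-1)(1-\mu)}{2}$, $$\left\|\Delta_k^+ +\frac{n+1-k}{n-k}\Delta_k^- +\bigl(k-(k+1)\theta\bigr)I-\left(\frac{(n+1-k)^2}{n-k}-(n+1-k)\,\theta\right)\sum_{j=0}^n\Delta^-_{(k,j)}\right\|\le (k+1)(n+1-k)\,\frac{1-\mu}{2},$$ where $\|\cdot\|$ is the operator norm. -/

import Mathlib

/-- A finite simplicial complex on a vertex set inside `V` together with a weight function.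
The empty simplex (of dimension `-1`) is a simplex; a simplex of dimension `k` is a member of
`faces` with `k + 1` elements. Elements of `V` need not be vertices of the complex. The weight
is a strictly positive function on the simplices (its values off the simplices are irrelevant). -/
structure WeightedComplex (V : Type*) [Fintype V] [DecidableEq V] where
  faces : Finset (Finset V)
  empty_mem : ∅ ∈ faces
  down_closed : ∀ σ ∈ faces, ∀ τ ⊆ σ, τ ∈ faces
  weight : Finset V → ℝ
  weight_pos : ∀ σ ∈ faces, 0 < weight σ

namespace WeightedComplex

section Complex

variable {V : Type*} [Fintype V] [DecidableEq V]

/-- `X` is pure of dimension `n`: no simplex has dimension `> n`, and every simplex lies in an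
`n`-dimensional one. -/
def IsPure (X : WeightedComplex V) (n : ℕ) : Prop :=
  (∀ σ ∈ X.faces, σ.card ≤ n + 1) ∧
    ∀ σ ∈ X.faces, ∃ η ∈ X.faces, σ ⊆ η ∧ η.card = n + 1

/-- The weight is balanced: for each simplex `τ` of dimension `-1 ≤ dim τ ≤ n - 1`, the weights
of the simplices of dimension `dim τ + 1` containing `τ` sum up to the weight of `τ`. -/
def IsBalanced (X : WeightedComplex V) (n : ℕ) : Prop :=
  ∀ τ ∈ X.faces, τ.card ≤ n →
    ∑ σ ∈ X.faces.filter (fun σ => τ ⊆ σ ∧ σ.card = τ.card + 1), X.weight σ = X.weight τ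

/-- The link of a simplex `τ`, with the weight `m_τ(σ) = m(τ ∪ σ)`. -/
def link (X : WeightedComplex V) (τ : Finset V) (hτ : τ ∈ X.faces) : WeightedComplex V where
  faces := X.faces.filter (fun σ => Disjoint τ σ ∧ τ ∪ σ ∈ X.faces)
  empty_mem := by simp [X.empty_mem, hτ]
  down_closed := by
    intro σ hσ ρ hρ
    simp only [Finset.mem_filter] at hσ ⊢
    exact ⟨X.down_closed σ hσ.1 ρ hρ, hσ.2.1.mono_right hρ,
      X.down_closed _ hσ.2.2 _ (Finset.union_subset_union_right hρ)⟩
  weight := fun σ => X.weight (τ ∪ σ)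
  weight_pos := by
    intro σ hσ
    exact X.weight_pos _ (Finset.mem_filter.mp hσ).2.2

/-- The `1`-skeleton of `X`, as a graph on the vertices of `X`. -/
def oneSkeleton (X : WeightedComplex V) : SimpleGraph {v : V // {v} ∈ X.faces} where
  Adj u v := u ≠ v ∧ ({u.1, v.1} : Finset V) ∈ X.faces
  symm := by
    refine ⟨?_⟩
    rintro u v ⟨h, h'⟩
    exact ⟨h.symm, by rwa [Finset.pair_comm]⟩
  loopless := ⟨fun u h => h.1 rfl⟩

/-- All links of dimension `> 0` of an `n`-dimensional complex are connected. The link of `τ` has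
dimension `n - τ.card`, and the link of the empty simplex is `X` itself. -/
def LinksConnected (X : WeightedComplex V) (n : ℕ) : Prop :=
  ∀ (τ : Finset V) (hτ : τ ∈ X.faces), τ.card < n → (X.link τ hτ).oneSkeleton.Connected

/-- `X` is `(n+1)`-partite with sides `S 0, …, S n`: the sides partition the set of vertices, and
the two ends of every edge lie on different sides. -/
def IsPartite (X : WeightedComplex V) (n : ℕ) (S : Fin (n + 1) → Finset V) : Prop :=
  (∀ v, {v} ∈ X.faces ↔ ∃ j, v ∈ S j) ∧
  (∀ i j, i ≠ j → Disjoint (S i) (S j)) ∧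
  ∀ u v, u ≠ v → ({u, v} : Finset V) ∈ X.faces → ∃ i j, i ≠ j ∧ u ∈ S i ∧ v ∈ S j

/-- Ordered simplices with `r` vertices, i.e. of dimension `r - 1`. -/
def OrdSimplex (X : WeightedComplex V) (r : ℕ) : Type _ :=
  {v : Fin r → V // Function.Injective v ∧ Finset.univ.image v ∈ X.faces}

noncomputable instance (X : WeightedComplex V) (r : ℕ) : Fintype (X.OrdSimplex r) :=
  Fintype.ofInjective (fun s : X.OrdSimplex r => s.1) Subtype.val_injective

/-- The weight of an ordered simplex is the weight of its set of vertices. -/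
def ordWeight (X : WeightedComplex V) {r : ℕ} (s : X.OrdSimplex r) : ℝ :=
  X.weight (Finset.univ.image s.1)

/-- `(v_{π 0}, …, v_{π (r-1)})`. -/
def OrdSimplex.permute {X : WeightedComplex V} {r : ℕ} (s : X.OrdSimplex r)
    (π : Equiv.Perm (Fin r)) : X.OrdSimplex r :=
  ⟨s.1 ∘ π, s.2.1.comp π.injective, by
    have : Finset.univ.image (s.1 ∘ π) = Finset.univ.image s.1 := by
      ext x
      simp only [Finset.mem_image, Finset.mem_univ, true_and, Function.comp]
      exact ⟨fun ⟨a, h⟩ => ⟨π a, h⟩, fun ⟨a, h⟩ => ⟨π.symm a, by simpa using h⟩⟩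
    rw [this]
    exact s.2.2⟩

/-- `(v_0, …, v̂_i, …, v_r)`. -/
def OrdSimplex.erase {X : WeightedComplex V} {r : ℕ} (s : X.OrdSimplex (r + 1))
    (i : Fin (r + 1)) : X.OrdSimplex r :=
  ⟨s.1 ∘ i.succAbove, s.2.1.comp Fin.succAbove_right_injective,
    X.down_closed _ s.2.2 _ (by
      intro x hx
      simp only [Finset.mem_image, Finset.mem_univ, true_and, Function.comp] at hx ⊢
      obtain ⟨a, rfl⟩ := hx
      exact ⟨_, rfl⟩)⟩

/-- The antisymmetric real functions on ordered simplices with `r` vertices. -/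
def antisymm (X : WeightedComplex V) (r : ℕ) : Submodule ℝ (X.OrdSimplex r → ℝ) where
  carrier := {φ | ∀ (s : X.OrdSimplex r) (π : Equiv.Perm (Fin r)),
    φ (s.permute π) = ((Equiv.Perm.sign π : ℤ) : ℝ) * φ s}
  add_mem' := by
    intro φ ψ hφ hψ s π
    simp only [Pi.add_apply, hφ s π, hψ s π]
    ring
  zero_mem' := by
    intro s π
    simp
  smul_mem' := by
    intro c φ hφ s π
    simp only [Pi.smul_apply, hφ s π, smul_eq_mul]
    ring

/-- The space `C^{r-1}(X, ℝ)` of `(r-1)`-forms: so `X.Cochain (k + 1)` is `C^k(X, ℝ)`, and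
`X.Cochain 0` is `C^{-1}(X, ℝ)`. It carries only the inner product defined below. -/
def Cochain (X : WeightedComplex V) (r : ℕ) : Type _ := ↥(X.antisymm r)

noncomputable instance (X : WeightedComplex V) (r : ℕ) : AddCommGroup (X.Cochain r) :=
  inferInstanceAs (AddCommGroup ↥(X.antisymm r))

noncomputable instance (X : WeightedComplex V) (r : ℕ) : Module ℝ (X.Cochain r) :=
  inferInstanceAs (Module ℝ ↥(X.antisymm r))

instance (X : WeightedComplex V) (r : ℕ) : FiniteDimensional ℝ (X.Cochain r) :=
  inferInstanceAs (FiniteDimensional ℝ ↥(X.antisymm r))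

theorem ordWeight_pos (X : WeightedComplex V) {r : ℕ} (s : X.OrdSimplex r) :
    0 < X.ordWeight s := X.weight_pos _ s.2.2

/-- The inner product `⟨φ, ψ⟩ = ∑_{s ∈ Σ(k)} m(s) / (k+1)! * φ(s) * ψ(s)` on `C^k(X, ℝ)`,
where `r = k + 1`. -/
@[reducible]
noncomputable def innerCore (X : WeightedComplex V) (r : ℕ) :
    InnerProductSpace.Core ℝ (X.Cochain r) where
  inner φ ψ := ∑ s : X.OrdSimplex r, X.ordWeight s / (r.factorial : ℝ) * φ.1 s * ψ.1 s
  conj_inner_symm := by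
    intro φ ψ
    simp only [conj_trivial]
    exact Finset.sum_congr rfl fun s _ => by ring
  re_inner_nonneg := by
    intro φ
    simp only [RCLike.re_to_real]
    refine Finset.sum_nonneg fun s _ => ?_
    rw [mul_assoc]
    exact mul_nonneg (div_nonneg (X.ordWeight_pos s).le (Nat.cast_nonneg _))
      (mul_self_nonneg _)
  add_left := by
    intro φ ψ χ
    rw [← Finset.sum_add_distrib]
    refine Finset.sum_congr rfl fun s _ => ?_
    change _ * (φ.1 s + ψ.1 s) * _ = _
    ring
  smul_left := by
    intro φ ψ c
    simp only [conj_trivial]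
    rw [Finset.mul_sum]
    refine Finset.sum_congr rfl fun s _ => ?_
    change _ * (c * φ.1 s) * _ = _
    ring
  definite := by
    intro φ h
    have hn : ∀ s ∈ (Finset.univ : Finset (X.OrdSimplex r)),
        0 ≤ X.ordWeight s / (r.factorial : ℝ) * φ.1 s * φ.1 s := by
      intro s _
      rw [mul_assoc]
      exact mul_nonneg (div_nonneg (X.ordWeight_pos s).le (Nat.cast_nonneg _))
        (mul_self_nonneg _)
    have h0 := (Finset.sum_eq_zero_iff_of_nonneg hn).mp h
    apply Subtype.ext
    funext s
    have hs := h0 s (Finset.mem_univ s)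
    have hc : X.ordWeight s / (r.factorial : ℝ) ≠ 0 :=
      (div_pos (X.ordWeight_pos s) (by exact_mod_cast r.factorial_pos)).ne'
    rw [mul_assoc] at hs
    rcases mul_eq_zero.mp hs with h1 | h1
    · exact absurd h1 hc
    · exact mul_self_eq_zero.mp h1

noncomputable instance (X : WeightedComplex V) (r : ℕ) : NormedAddCommGroup (X.Cochain r) :=
  (X.innerCore r).toNormedAddCommGroup

noncomputable instance (X : WeightedComplex V) (r : ℕ) : InnerProductSpace ℝ (X.Cochain r) :=
  InnerProductSpace.ofCore (X.innerCore r).toCore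

/-- An alternating sum over the vertices, weighted by any function of the vertex left out, is
antisymmetric. -/
theorem antisymm_sum (X : WeightedComplex V) {r : ℕ} (c : V → ℝ) (φ : X.Cochain r) :
    (fun s : X.OrdSimplex (r + 1) =>
      ∑ i : Fin (r + 1), (-1 : ℝ) ^ (i : ℕ) * c (s.1 i) * φ.1 (s.erase i)) ∈
      X.antisymm (r + 1) := by
  intro s π
  let e : Fin (r + 1) → Equiv.Perm (Fin (r + 1)) := fun i => i.cycleRange.symm
  have he0 : ∀ i, e i 0 = i := fun i => Fin.cycleRange_symm_zero i
  have hes : ∀ i, ((Equiv.Perm.sign (e i) : ℤ) : ℝ) = (-1 : ℝ) ^ (i : ℕ) := by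
    intro i
    simp [e, Equiv.Perm.sign_symm, Fin.sign_cycleRange]
  have her : ∀ (t : X.OrdSimplex (r + 1)) i, t.erase i = (t.permute (e i)).erase 0 := by
    intro t i
    apply Subtype.ext
    funext j
    simp [OrdSimplex.erase, OrdSimplex.permute, e, Fin.cycleRange_symm_succ]
  have key : ∀ i : Fin (r + 1), (-1 : ℝ) ^ (i : ℕ) * c ((s.permute π).1 i) * φ.1 ((s.permute π).erase i) =
      ((Equiv.Perm.sign π : ℤ) : ℝ) *
        ((-1 : ℝ) ^ (π i : ℕ) * c (s.1 (π i)) * φ.1 (s.erase (π i))) := by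
    intro i
    let κ : Equiv.Perm (Fin (r + 1)) := (e (π i))⁻¹ * π * e i
    have hκ0 : κ 0 = 0 := by
      simp only [κ, Equiv.Perm.mul_apply, he0]
      rw [Equiv.Perm.inv_eq_iff_eq, he0]
    obtain ⟨⟨p, ε⟩, hp⟩ := Equiv.Perm.decomposeFin.symm.surjective κ
    have hp0 : p = 0 := by
      rw [← hκ0, ← hp]
      simp
    subst hp0
    have hsign : Equiv.Perm.sign κ = Equiv.Perm.sign ε := by
      rw [← hp]
      simp
    have hperm : (s.permute π).permute (e i) = (s.permute (e (π i))).permute κ := by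
      apply Subtype.ext
      funext j
      simp [OrdSimplex.permute, κ]
    have hE : ((s.permute (e (π i))).permute κ).erase 0 =
        ((s.permute (e (π i))).erase 0).permute ε := by
      apply Subtype.ext
      funext j
      have : κ j.succ = (ε j).succ := by
        rw [← hp]
        simp
      simp [OrdSimplex.permute, OrdSimplex.erase, this]
    rw [her (s.permute π) i, hperm, hE, φ.2, ← her s (π i), ← hsign, ← hes i, ← hes (π i)]
    have hc : c ((s.permute π).1 i) = c (s.1 (π i)) := rfl
    rw [hc]
    have h1 : ((Equiv.Perm.sign κ : ℤ) : ℝ) = ((Equiv.Perm.sign (e (π i)) : ℤ) : ℝ) *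
        ((Equiv.Perm.sign π : ℤ) : ℝ) * ((Equiv.Perm.sign (e i) : ℤ) : ℝ) := by
      simp [κ, Equiv.Perm.sign_mul, Equiv.Perm.sign_inv]
    have h2 : ((Equiv.Perm.sign (e i) : ℤ) : ℝ) * ((Equiv.Perm.sign (e i) : ℤ) : ℝ) = 1 := by
      rw [hes, ← mul_pow]
      simp
    rw [h1]
    linear_combination (((Equiv.Perm.sign (e (π i)) : ℤ) : ℝ) *
        ((Equiv.Perm.sign π : ℤ) : ℝ) * c (s.1 (π i)) * φ.1 (s.erase (π i))) * h2
  change ∑ i : Fin (r + 1), (-1 : ℝ) ^ (i : ℕ) * c ((s.permute π).1 i) *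
    φ.1 ((s.permute π).erase i) = _ * ∑ i : Fin (r + 1), (-1 : ℝ) ^ (i : ℕ) * c (s.1 i) *
    φ.1 (s.erase i)
  rw [Finset.sum_congr rfl fun i _ => key i, ← Finset.mul_sum]
  congr 1
  exact Equiv.sum_comp π
    (fun i => (-1 : ℝ) ^ (i : ℕ) * c (s.1 i) * φ.1 (s.erase i))

/-- The differential `d : C^{r-1}(X, ℝ) → C^r(X, ℝ)`,
`(d φ)(v_0, …, v_r) = ∑ i, (-1)^i φ(v_0, …, v̂_i, …, v_r)`. -/
noncomputable def diff (X : WeightedComplex V) (r : ℕ) : X.Cochain r →ₗ[ℝ] X.Cochain (r + 1) where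
  toFun φ := ⟨fun s => ∑ i : Fin (r + 1), (-1 : ℝ) ^ (i : ℕ) * φ.1 (s.erase i), by
    simpa using X.antisymm_sum (fun _ => 1) φ⟩
  map_add' φ ψ := by
    apply Subtype.ext
    funext s
    change ∑ i : Fin (r + 1), (-1 : ℝ) ^ (i : ℕ) * (φ.1 (s.erase i) + ψ.1 (s.erase i)) =
      ∑ i : Fin (r + 1), (-1 : ℝ) ^ (i : ℕ) * φ.1 (s.erase i) +
        ∑ i : Fin (r + 1), (-1 : ℝ) ^ (i : ℕ) * ψ.1 (s.erase i)
    rw [← Finset.sum_add_distrib]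
    exact Finset.sum_congr rfl fun i _ => by ring
  map_smul' a φ := by
    apply Subtype.ext
    funext s
    change ∑ i : Fin (r + 1), (-1 : ℝ) ^ (i : ℕ) * (a * φ.1 (s.erase i)) =
      a * ∑ i : Fin (r + 1), (-1 : ℝ) ^ (i : ℕ) * φ.1 (s.erase i)
    rw [Finset.mul_sum]
    exact Finset.sum_congr rfl fun i _ => by ring

/-- The differential of a side `T`, `C^{r-1}(X, ℝ) → C^r(X, ℝ)`: its value at `(v_0, …, v_r)` is
`0` if no `v_i` is in `T`, and `(-1)^i φ(v_0, …, v̂_i, …, v_r)` if `v_i ∈ T`. (A simplex of a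
partite complex has at most one vertex on a side, so the sum has at most one nonzero term.) -/
noncomputable def sideDiff (X : WeightedComplex V) (T : Finset V) (r : ℕ) :
    X.Cochain r →ₗ[ℝ] X.Cochain (r + 1) where
  toFun φ := ⟨fun s => ∑ i : Fin (r + 1),
      if s.1 i ∈ T then (-1 : ℝ) ^ (i : ℕ) * φ.1 (s.erase i) else 0, by
    simpa using X.antisymm_sum (fun v => if v ∈ T then 1 else 0) φ⟩
  map_add' φ ψ := by
    apply Subtype.ext
    funext s
    change (∑ i : Fin (r + 1), if s.1 i ∈ T then (-1 : ℝ) ^ (i : ℕ) * (φ.1 (s.erase i) + ψ.1 (s.erase i)) else 0) =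
      (∑ i : Fin (r + 1), if s.1 i ∈ T then (-1 : ℝ) ^ (i : ℕ) * φ.1 (s.erase i) else 0) +
        ∑ i : Fin (r + 1), if s.1 i ∈ T then (-1 : ℝ) ^ (i : ℕ) * ψ.1 (s.erase i) else 0
    rw [← Finset.sum_add_distrib]
    exact Finset.sum_congr rfl fun i _ => by split_ifs <;> simp [mul_add]
  map_smul' a φ := by
    apply Subtype.ext
    funext s
    change (∑ i : Fin (r + 1), if s.1 i ∈ T then (-1 : ℝ) ^ (i : ℕ) * (a * φ.1 (s.erase i)) else 0) =
      a * ∑ i : Fin (r + 1), if s.1 i ∈ T then (-1 : ℝ) ^ (i : ℕ) * φ.1 (s.erase i) else 0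
    rw [Finset.mul_sum]
    exact Finset.sum_congr rfl fun i _ => by split_ifs <;> simp [mul_left_comm]

/-- The upper Laplacian `Δ⁺_k = δ_k d_k` on `C^k(X, ℝ)`, with `δ_k` the adjoint of `d_k`. -/
noncomputable def upperLaplacian (X : WeightedComplex V) (k : ℕ) :
    Module.End ℝ (X.Cochain (k + 1)) :=
  LinearMap.adjoint (X.diff (k + 1)) ∘ₗ X.diff (k + 1)

/-- The lower Laplacian `Δ⁻_k = d_{k-1} δ_{k-1}` on `C^k(X, ℝ)`. -/
noncomputable def lowerLaplacian (X : WeightedComplex V) (k : ℕ) :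
    Module.End ℝ (X.Cochain (k + 1)) :=
  X.diff k ∘ₗ LinearMap.adjoint (X.diff k)

/-- For a side `T = S_j`, the operator `Δ⁻_{(k,j)} = d_{(k-1,j)} δ_{(k-1,j)}` on `C^k(X, ℝ)`,
with `δ_{(k-1,j)}` the adjoint of `d_{(k-1,j)}`. -/
noncomputable def sideLaplacian (X : WeightedComplex V) (T : Finset V) (k : ℕ) :
    Module.End ℝ (X.Cochain (k + 1)) :=
  X.sideDiff T k ∘ₗ LinearMap.adjoint (X.sideDiff T k)

end Complex

end WeightedComplex

/-- The operator norm of an endomorphism of a finite-dimensional inner product space. -/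
noncomputable def operatorNorm {E : Type*} [NormedAddCommGroup E] [InnerProductSpace ℝ E]
    [FiniteDimensional ℝ E] (A : Module.End ℝ E) : ℝ :=
  ‖LinearMap.toContinuousLinearMap A‖

/-- `f(x) = 2 - 1 / x`. -/
noncomputable def gapMap (x : ℝ) : ℝ := 2 - 1 / x

/-! The operator is symmetric, so it suffices to bound its quadratic form by a multiple of `⟨φ, φ⟩`.
Following Garland, this form is localised to the links of the (k-1)-simplices `t`: put `N = n - k`
and `g_t(v) = φ(v, t)`, and let `w`, `p` be the vertex and edge weights of the link. With `Q = ∑ w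
g²` and `B = ∑ p g g`, the sum of `Q` over tuples `t`, divided by `k!`, is `(k+1)⟨φ, φ⟩`, while `Δ⁺`
gives `⟨φ, φ⟩` minus the same sum of `B`. The term `k I` turns this `⟨φ, φ⟩` into the sum of `Q`.
The lower Laplacians give squares of the total, or colourwise, sums of `w g`, divided by the weight
of `t`.

The link has `N + 1` colours, and balance forces them to share the weight equally, both globally and
around each vertex (`IsColoring.sum_linkWeight_color`). Write `g = r + s` with `s` constant on
colour classes and `r` orthogonal to them. The pairing `p` acts on `s` as the random walk on a
complete graph with `N + 1` vertices, so the coefficients of the lower terms can be, and are, chosen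
to cancel `s` completely. What remains is `(1 - θ) Q(r) - B(r)`. A gap `μ` in the link gives `B(r) ≤
(1 - μ) Q(r)`, and partiteness turns the same gap into `-B(r) ≤ N (1 - μ) Q(r)`
(`PartiteWeights.neg_form_le`). The number `θ` centres the resulting interval at `0`, and its
half-length is `(N + 1)(1 - μ)/2`.

The gap `μ` comes from the hypothesis on (n-2)-simplices by spectral descent
(`le_of_mem_spectrum_link`), each step down in dimension costing one application of `f`. Finally `1
- μ ≥ 0` is needed: a gap greater than `1` would contradict the two bounds unless `X` is a single
n-simplex. -/

namespace LinearMap.IsSymmetric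

/-! ### Quadratic forms of symmetric operators -/

variable {E : Type*} [NormedAddCommGroup E] [InnerProductSpace ℝ E] [FiniteDimensional ℝ E]

theorem inner_apply_eq_sum {T : E →ₗ[ℝ] E} (hT : T.IsSymmetric) (x y : E) :
    inner ℝ (T x) y = ∑ i, hT.eigenvalues rfl i *
      (inner ℝ (hT.eigenvectorBasis rfl i) x * inner ℝ (hT.eigenvectorBasis rfl i) y) := by
  rw [← (hT.eigenvectorBasis rfl).sum_inner_mul_inner (T x) y]
  refine Finset.sum_congr rfl fun i _ => ?_
  rw [hT x, hT.apply_eigenvectorBasis, inner_smul_right, real_inner_comm x]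
  simp [mul_assoc]

/-- In an eigenbasis, orthogonality to the kernel kills the coefficients at eigenvalue `0`; the
remaining eigenvalues are at least `c`. -/
theorem le_inner_apply_of_eigenvalues {T : E →ₗ[ℝ] E} (hT : T.IsSymmetric) {c : ℝ}
    (hc : ∀ t ∈ spectrum ℝ T, t ≠ 0 → c ≤ t) {x : E}
    (hx : ∀ y, T y = 0 → inner ℝ y x = 0) : c * inner ℝ x x ≤ inner ℝ (T x) x := by
  rw [hT.inner_apply_eq_sum, ← (hT.eigenvectorBasis rfl).sum_inner_mul_inner x x, Finset.mul_sum]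
  refine Finset.sum_le_sum fun i _ => ?_
  rw [real_inner_comm _ x]
  by_cases h0 : hT.eigenvalues rfl i = 0
  · have : inner ℝ (hT.eigenvectorBasis rfl i) x = 0 := by
      apply hx
      rw [hT.apply_eigenvectorBasis, h0]
      simp
    simp [this]
  · refine mul_le_mul_of_nonneg_right (hc _ ?_ h0) (mul_self_nonneg _)
    exact (hT.hasEigenvalue_eigenvalues rfl i).mem_spectrum

end LinearMap.IsSymmetric

/-- Testing the form on eigenvectors bounds every eigenvalue by `c` in absolute value, and the norm
of a symmetric operator is controlled by its eigenvalues. -/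
theorem operatorNorm_le_of_abs_inner_le {E : Type*} [NormedAddCommGroup E] [InnerProductSpace ℝ E]
    [FiniteDimensional ℝ E] {T : Module.End ℝ E} (hT : LinearMap.IsSymmetric T) {c : ℝ} (hc0 : 0 ≤ c)
    (hc : ∀ x, |inner ℝ (T x) x| ≤ c * inner ℝ x x) : operatorNorm T ≤ c := by
  refine ContinuousLinearMap.opNorm_le_bound _ hc0 fun x => ?_
  change ‖T x‖ ≤ _
  have he : ∀ i, |hT.eigenvalues rfl i| ≤ c := by
    intro i
    have h := hc (hT.eigenvectorBasis rfl i)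
    rw [hT.apply_eigenvectorBasis, inner_smul_left] at h
    simpa using h
  rw [← Real.sqrt_sq hc0, ← Real.sqrt_sq (norm_nonneg x), ← Real.sqrt_sq (norm_nonneg (T x)),
    ← Real.sqrt_mul (sq_nonneg c)]
  apply Real.sqrt_le_sqrt
  rw [← real_inner_self_eq_norm_sq, ← real_inner_self_eq_norm_sq, hT.inner_apply_eq_sum,
    ← (hT.eigenvectorBasis rfl).sum_inner_mul_inner x x, Finset.mul_sum]
  refine Finset.sum_le_sum fun i _ => ?_
  rw [← hT (hT.eigenvectorBasis rfl i) x, hT.apply_eigenvectorBasis, inner_smul_left,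
    real_inner_comm _ x]
  have h2 : (hT.eigenvalues rfl i) ^ 2 ≤ c ^ 2 := sq_le_sq' (abs_le.mp (he i)).1 (abs_le.mp (he i)).2
  have := mul_le_mul_of_nonneg_right h2 (mul_self_nonneg (inner ℝ (hT.eigenvectorBasis rfl i) x))
  simp only [RCLike.ofReal_real_eq_id, id_eq, conj_trivial]
  linarith

/-! ### The local inequality on one partite link -/

section PartiteForms

open Finset

/-- Weights `w` on points and `p` on pairs of points of a finite set `V` coloured by the
`N + 1` colours in `J`, such that each colour class meets the weights uniformly. -/
structure PartiteWeights {V ι : Type*} [Fintype V] [Fintype ι] [DecidableEq ι]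
    (w : V → ℝ) (p : V → V → ℝ) (col : V → ι) (J : Finset ι) (N : ℕ) (m : ℝ) : Prop where
  N_pos : 0 < N
  card_colors : J.card = N + 1
  m_pos : 0 < m
  nonneg : ∀ v, 0 ≤ w v
  symm : ∀ u v, p u v = p v u
  proper : ∀ u v, col u = col v → p u v = 0
  col_mem : ∀ v, w v ≠ 0 → col v ∈ J
  sum_color : ∀ j ∈ J, ∑ v, (if col v = j then w v else 0) = m / (N + 1)
  sum_pair : ∀ u, ∀ j ∈ J, col u ≠ j → ∑ v, (if col v = j then p u v else 0) = w u / N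
  pair_zero : ∀ u v, w v = 0 → p u v = 0

variable {V ι : Type*} [Fintype V] [Fintype ι] [DecidableEq ι]
  {w : V → ℝ} {p : V → V → ℝ} {col : V → ι} {J : Finset ι} {N : ℕ} {m : ℝ}

namespace PartiteWeights

theorem sum_mul_color (hw : PartiteWeights w p col J N m) (a : ι → ℝ) (h : V → ℝ) :
    ∑ v, w v * (a (col v) * h v) = ∑ j ∈ J, a j * ∑ v, if col v = j then w v * h v else 0 := by
  simp_rw [Finset.mul_sum]
  rw [Finset.sum_comm]
  refine Finset.sum_congr rfl fun v _ => ?_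
  by_cases hv : w v = 0
  · simp [hv]
  · simp only [mul_ite, mul_zero]
    rw [Finset.sum_ite_eq, if_pos (hw.col_mem v hv)]
    ring

theorem sum_pair_mul_color (hw : PartiteWeights w p col J N m) (a : ι → ℝ) (u : V)
    (hu : col u ∈ J) :
    ∑ v, p u v * a (col v) = w u / N * (∑ j ∈ J, a j - a (col u)) := by
  have h1 : ∀ v, p u v * a (col v) = ∑ j ∈ J, a j * (if col v = j then p u v else 0) := by
    intro v
    by_cases hv : w v = 0
    · simp [hw.pair_zero u v hv]
    · simp only [mul_ite, mul_zero]
      rw [Finset.sum_ite_eq, if_pos (hw.col_mem v hv)]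
      ring
  simp_rw [h1]
  rw [Finset.sum_comm]
  simp_rw [← Finset.mul_sum]
  rw [← Finset.add_sum_erase _ _ hu, ← Finset.add_sum_erase _ a hu]
  have h2 : ∑ v, (if col v = col u then p u v else 0) = 0 :=
    Finset.sum_eq_zero fun v _ => by
      split_ifs with h
      · exact hw.proper u v h.symm
      · rfl
  rw [h2, mul_zero, zero_add, add_sub_cancel_left, Finset.mul_sum]
  refine Finset.sum_congr rfl fun j hj => ?_
  rw [hw.sum_pair u j (Finset.mem_of_mem_erase hj) (Finset.ne_of_mem_erase hj).symm]
  ring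

/-- If the form `∑ w r² - ∑ p r r` has gap `c` on functions orthogonal to constants, then it is
bounded above on functions orthogonal to all colour classes. -/
theorem neg_form_le (hw : PartiteWeights w p col J N m) {c : ℝ}
    (hgap : ∀ g : V → ℝ, ∑ v, w v * g v = 0 →
      ∑ u, ∑ v, p u v * (g u * g v) ≤ (1 - c) * ∑ v, w v * g v ^ 2)
    (r : V → ℝ) (hr : ∀ j ∈ J, ∑ v, (if col v = j then w v * r v else 0) = 0) :
    -∑ u, ∑ v, p u v * (r u * r v) ≤ N * (1 - c) * ∑ v, w v * r v ^ 2 := by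
  have hN : (0 : ℝ) < N := by exact_mod_cast hw.N_pos
  set B := ∑ u, ∑ v, p u v * (r u * r v) with hB
  set Q := ∑ v, w v * r v ^ 2 with hQ
  -- Multiply `r` by `-N` on colour `j` and leave it elsewhere. This stays orthogonal to constants,
  -- so the gap applies for each `j`. Summed over `j`, an edge, having ends of two different
  -- colours, gets the factor `(N - 1) - 2N = -(N + 1)`, and a vertex gets `N² + N`.
  let g : ι → V → ℝ := fun j v => (1 - (N + 1) * if col v = j then 1 else 0) * r v
  have key : ∀ j ∈ J, ∑ u, ∑ v, p u v * (g j u * g j v) ≤ (1 - c) * ∑ v, w v * g j v ^ 2 := by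
    intro j hj
    apply hgap
    have := hw.sum_mul_color (fun i => 1 - (N + 1) * if i = j then 1 else 0) r
    simp only [g]
    rw [this]
    refine Finset.sum_eq_zero fun i hi => ?_
    rw [hr i hi, mul_zero]
  have hcard : ∑ j ∈ J, (1 : ℝ) = N + 1 := by
    rw [Finset.sum_const, hw.card_colors]; simp
  have hL : ∑ j ∈ J, ∑ u, ∑ v, p u v * (g j u * g j v) = -(N + 1) * B := by
    rw [Finset.sum_comm, hB, Finset.mul_sum]
    refine Finset.sum_congr rfl fun u _ => ?_
    rw [Finset.sum_comm, Finset.mul_sum]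
    refine Finset.sum_congr rfl fun v _ => ?_
    by_cases hp : p u v = 0
    · simp [hp]
    have hu : col u ∈ J := hw.col_mem u fun h => hp (by rw [hw.symm, hw.pair_zero _ _ h])
    have hv : col v ∈ J := hw.col_mem v fun h => hp (hw.pair_zero _ _ h)
    have huv : col u ≠ col v := fun h => hp (hw.proper u v h)
    have : ∀ j ∈ J, p u v * (g j u * g j v) = p u v * (r u * r v) *
        (1 - (N + 1) * (if col u = j then 1 else 0) - (N + 1) * (if col v = j then 1 else 0)) := by
      intro j _
      have h0 : (if col u = j then (1 : ℝ) else 0) * (if col v = j then (1 : ℝ) else 0) = 0 := by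
        split_ifs with h1 h2
        · exact absurd (h1.trans h2.symm) huv
        all_goals simp
      simp only [g]
      linear_combination p u v * (r u * r v) * (N + 1) ^ 2 * h0
    rw [Finset.sum_congr rfl this, ← Finset.mul_sum, Finset.sum_sub_distrib,
      Finset.sum_sub_distrib, ← Finset.mul_sum, ← Finset.mul_sum, hcard, Finset.sum_ite_eq,
      Finset.sum_ite_eq, if_pos hu, if_pos hv]
    ring
  have hR : ∑ j ∈ J, (1 - c) * ∑ v, w v * g j v ^ 2 = (1 - c) * ((N + 1) * N * Q) := by
    rw [← Finset.mul_sum, Finset.sum_comm]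
    congr 1
    rw [hQ, Finset.mul_sum]
    refine Finset.sum_congr rfl fun v _ => ?_
    by_cases hv0 : w v = 0
    · simp [hv0]
    have hv : col v ∈ J := hw.col_mem v hv0
    have : ∀ j ∈ J, w v * g j v ^ 2 = w v * r v ^ 2 *
        (1 + ((N : ℝ) ^ 2 - 1) * (if col v = j then 1 else 0)) := by
      intro j _
      simp only [g]
      split_ifs <;> ring
    rw [Finset.sum_congr rfl this, ← Finset.mul_sum, Finset.sum_add_distrib,
      ← Finset.mul_sum, hcard, Finset.sum_ite_eq, if_pos hv]
    ring
  have := Finset.sum_le_sum key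
  rw [hL, hR] at this
  have h2 : (N + 1 : ℝ) * -B ≤ (N + 1 : ℝ) * (N * (1 - c) * Q) := by linarith
  exact le_of_mul_le_mul_left h2 (by positivity)

/-- The part of `g` constant on colours contributes nothing, and the gap together with `neg_form_le`
confines the form of the other part to an interval centred at `0` by the choice of `θ`. -/
theorem abs_form_le (hw : PartiteWeights w p col J N m) {c θ : ℝ} (hc : c ≤ 1)
    (hθ : θ = (2 + ((N : ℝ) - 1) * (1 - c)) / 2)
    (hgap : ∀ g : V → ℝ, ∑ v, w v * g v = 0 →
      ∑ u, ∑ v, p u v * (g u * g v) ≤ (1 - c) * ∑ v, w v * g v ^ 2)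
    (g : V → ℝ) :
    |(∑ v, w v * g v ^ 2 - ∑ u, ∑ v, p u v * (g u * g v))
      + (N + 1) / N * ((∑ v, w v * g v) ^ 2 / m) - θ * ∑ v, w v * g v ^ 2
      - ((N + 1) ^ 2 / N - (N + 1) * θ) *
        ∑ j ∈ J, (∑ v, if col v = j then w v * g v else 0) ^ 2 / m| ≤
      (N + 1) * ((1 - c) / 2) * ∑ v, w v * g v ^ 2 := by
  have hN : (0 : ℝ) < N := by exact_mod_cast hw.N_pos
  have hm := hw.m_pos
  set L : ι → ℝ := fun j => ∑ v, if col v = j then w v * g v else 0 with hL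
  -- The mean of `g` on colour `j`, since each colour has total weight `m / (N + 1)`; `r` is then
  -- orthogonal to every function of the colour.
  let a : ι → ℝ := fun j => (N + 1) * L j / m
  let s : V → ℝ := fun v => a (col v)
  let r : V → ℝ := fun v => g v - s v
  have hLsum : ∑ v, w v * g v = ∑ j ∈ J, L j := by
    simpa using hw.sum_mul_color (fun _ => 1) g
  have hs : ∀ j ∈ J, ∑ v, (if col v = j then w v * s v else 0) = L j := by
    intro j hj
    have : ∀ v, (if col v = j then w v * s v else 0) = a j * if col v = j then w v else 0 := by
      intro v
      split_ifs with h
      · simp only [s, h]; ring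
      · simp
    simp_rw [this]
    rw [← Finset.mul_sum, hw.sum_color j hj]
    simp only [a]
    field_simp
  have hr : ∀ j ∈ J, ∑ v, (if col v = j then w v * r v else 0) = 0 := by
    intro j hj
    have : ∀ v, (if col v = j then w v * r v else 0) =
        (if col v = j then w v * g v else 0) - (if col v = j then w v * s v else 0) := by
      intro v
      split_ifs
      · simp only [r]; ring
      · simp
    simp_rw [this]
    rw [Finset.sum_sub_distrib, hs j hj, sub_self]
  have hcolor : ∀ b : ι → ℝ, ∑ v, w v * (b (col v) * r v) = 0 := by
    intro b
    rw [hw.sum_mul_color]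
    exact Finset.sum_eq_zero fun j hj => by rw [hr j hj, mul_zero]
  set Qs := (N + 1) * ∑ j ∈ J, L j ^ 2 / m with hQs
  set C := (∑ j ∈ J, L j) ^ 2 / m with hC
  have hss : ∑ v, w v * s v ^ 2 = Qs := by
    have := hw.sum_mul_color a s
    simp only [s] at this hs ⊢
    simp_rw [sq]
    rw [this, hQs, Finset.mul_sum]
    refine Finset.sum_congr rfl fun j hj => ?_
    rw [hs j hj]
    simp only [a]
    ring
  have hQ : ∑ v, w v * g v ^ 2 = ∑ v, w v * r v ^ 2 + Qs := by
    have h0 := hcolor a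
    rw [← hss, ← Finset.sum_add_distrib, ← sub_eq_zero, ← Finset.sum_sub_distrib]
    rw [← mul_zero 2, ← h0, Finset.mul_sum]
    refine Finset.sum_congr rfl fun v _ => ?_
    simp only [r, s]
    ring
  have hA : ∑ j ∈ J, a j = (N + 1) * (∑ j ∈ J, L j) / m := by
    simp only [a]
    rw [← Finset.sum_div, Finset.mul_sum]
  -- Each vertex spreads its weight evenly over the `N` other colours, so pairing with a function of
  -- the colour yields again a function of the colour.
  have hps : ∀ h : V → ℝ, ∑ u, ∑ v, p u v * (h u * s v) =
      ∑ u, w u * (((∑ j ∈ J, a j - a (col u)) / N) * h u) := by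
    intro h
    refine Finset.sum_congr rfl fun u _ => ?_
    by_cases hu0 : w u = 0
    · rw [hu0, zero_mul]
      exact Finset.sum_eq_zero fun v _ => by rw [hw.symm, hw.pair_zero v u hu0, zero_mul]
    have := hw.sum_pair_mul_color a u (hw.col_mem u hu0)
    calc ∑ v, p u v * (h u * s v) = h u * ∑ v, p u v * a (col v) := by
          rw [Finset.mul_sum]
          exact Finset.sum_congr rfl fun v _ => by simp only [s]; ring
      _ = _ := by rw [this]; ring
  have hrs : ∑ u, ∑ v, p u v * (r u * s v) = 0 := by
    rw [hps r]
    exact hcolor fun i => (∑ j ∈ J, a j - a i) / N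
  have hsr : ∑ u, ∑ v, p u v * (s u * r v) = 0 := by
    rw [← hrs, Finset.sum_comm]
    refine Finset.sum_congr rfl fun u _ => Finset.sum_congr rfl fun v _ => ?_
    rw [hw.symm]; ring
  have hssp : ∑ u, ∑ v, p u v * (s u * s v) = ((N + 1) * C - Qs) / N := by
    rw [hps s]
    have h1 : ∀ u, w u * ((∑ j ∈ J, a j - a (col u)) / N * s u) =
        (∑ j ∈ J, a j) / N * (w u * (1 * s u)) - (w u * s u ^ 2) / N := by
      intro u
      simp only [s]
      ring
    have h2 : ∑ u, w u * s u ^ 2 / N = Qs / N := by rw [← hss, Finset.sum_div]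
    have h3 : ∑ u, w u * (1 * s u) = ∑ j ∈ J, L j := by
      rw [hw.sum_mul_color (fun _ => 1) s]
      exact Finset.sum_congr rfl fun j hj => by rw [hs j hj, one_mul]
    rw [Finset.sum_congr rfl fun u _ => h1 u, Finset.sum_sub_distrib, ← Finset.mul_sum, h2, h3, hA,
      hC]
    ring
  have hB : ∑ u, ∑ v, p u v * (g u * g v) =
      ∑ u, ∑ v, p u v * (r u * r v) + ((N + 1) * C - Qs) / N := by
    rw [← hssp, ← add_zero (∑ u, ∑ v, p u v * (r u * r v)), ← hrs,
      ← add_zero (∑ u, ∑ v, p u v * (s u * s v)), ← hsr]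
    simp_rw [← Finset.sum_add_distrib]
    refine Finset.sum_congr rfl fun u _ => Finset.sum_congr rfl fun v _ => ?_
    simp only [r]
    ring
  have hr1 : ∑ v, w v * r v = 0 := by simpa using hcolor fun _ => 1
  have hup := hw.neg_form_le hgap r hr
  have hlo := hgap r hr1
  have hQs0 : 0 ≤ Qs := by
    rw [← hss]
    exact Finset.sum_nonneg fun v _ => mul_nonneg (hw.nonneg v) (sq_nonneg _)
  have hsum : ∑ j ∈ J, L j ^ 2 / m = Qs / (N + 1) := by
    rw [hQs]; field_simp
  rw [hB, hQ, hLsum, ← hC, hsum]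
  set Qr := ∑ v, w v * r v ^ 2
  set Br := ∑ u, ∑ v, p u v * (r u * r v)
  -- All terms in `Qs` and `C` cancel; the coefficients of the form are those that make this happen.
  have hX : Qr + Qs - (Br + ((N + 1) * C - Qs) / N) + (N + 1) / N * C - θ * (Qr + Qs)
      - ((N + 1) ^ 2 / N - (N + 1) * θ) * (Qs / (N + 1)) = (1 - θ) * Qr - Br := by
    field_simp
    ring
  rw [hX, hθ]
  have h3 : 0 ≤ (N + 1) * ((1 - c) / 2) * Qs :=
    mul_nonneg (mul_nonneg (by positivity) (by linarith)) hQs0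
  -- Since `1 - θ = -(N - 1)(1 - c)/2`, the bounds `hlo` and `hup` on `Br` give the two ends `∓(N +
  -- 1)(1 - c)/2` times `Qr`.
  rw [abs_le]
  constructor <;> nlinarith

/-- Adding the upper bounds for the form and for its negative gives `0 ≤ (N + 1)(1 - c) ∑ w r²`,
whose right side is negative unless every term vanishes. -/
theorem eq_zero_of_gap (hw : PartiteWeights w p col J N m) {c : ℝ} (hc : 1 < c)
    (hgap : ∀ g : V → ℝ, ∑ v, w v * g v = 0 →
      ∑ u, ∑ v, p u v * (g u * g v) ≤ (1 - c) * ∑ v, w v * g v ^ 2)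
    (r : V → ℝ) (hr : ∀ j ∈ J, ∑ v, (if col v = j then w v * r v else 0) = 0) (v : V) :
    w v * r v ^ 2 = 0 := by
  have hup := hw.neg_form_le hgap r hr
  have hlo := hgap r (by
    have := hw.sum_mul_color (fun _ => 1) r
    simp only [one_mul] at this
    rw [this]
    exact Finset.sum_eq_zero hr)
  have hn : ∀ v ∈ Finset.univ, 0 ≤ w v * r v ^ 2 :=
    fun v _ => mul_nonneg (hw.nonneg v) (sq_nonneg _)
  have h0 := Finset.sum_nonneg hn
  have hz : ∑ v, w v * r v ^ 2 = 0 := by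
    have : (N + 1 : ℝ) * (c - 1) * ∑ v, w v * r v ^ 2 ≤ 0 := by linarith
    have hp : (0 : ℝ) < (N + 1) * (c - 1) := mul_pos (by positivity) (by linarith)
    by_contra hne
    have := mul_pos hp (lt_of_le_of_ne h0 (Ne.symm hne))
    linarith
  exact (Finset.sum_eq_zero_iff_of_nonneg hn).mp hz v (Finset.mem_univ v)

end PartiteWeights

end PartiteForms

/-! ### Weights of links and colourings -/

namespace WeightedComplex

open Finset

variable {V : Type*} [Fintype V] [DecidableEq V] (X : WeightedComplex V)

/-- The weight, extended by zero to the sets which are not simplices. -/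
def faceWeight (σ : Finset V) : ℝ := if σ ∈ X.faces then X.weight σ else 0

/-- The weight of the vertex `u` in the link of `τ`. -/
def linkWeight (τ : Finset V) (u : V) : ℝ := if u ∈ τ then 0 else X.faceWeight (insert u τ)

/-- The weight of the edge `{u, v}` in the link of `τ`. -/
def pairWeight (τ : Finset V) (u v : V) : ℝ := if v ∈ τ then 0 else X.linkWeight (insert v τ) u

variable {X}

theorem faceWeight_nonneg (σ : Finset V) : 0 ≤ X.faceWeight σ := by
  unfold faceWeight
  split_ifs with h
  · exact (X.weight_pos σ h).le
  · exact le_rfl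

theorem faceWeight_ne_zero {σ : Finset V} : X.faceWeight σ ≠ 0 ↔ σ ∈ X.faces := by
  unfold faceWeight
  split_ifs with h
  · simpa [h] using (X.weight_pos σ h).ne'
  · simp [h]

theorem linkWeight_nonneg (τ : Finset V) (u : V) : 0 ≤ X.linkWeight τ u := by
  unfold linkWeight
  split_ifs
  · exact le_rfl
  · exact faceWeight_nonneg _

theorem linkWeight_ne_zero {τ : Finset V} {u : V} :
    X.linkWeight τ u ≠ 0 ↔ u ∉ τ ∧ insert u τ ∈ X.faces := by
  unfold linkWeight
  split_ifs with h
  · simp [h]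
  · simp [h, faceWeight_ne_zero]

theorem pairWeight_ne_zero {τ : Finset V} {u v : V} :
    X.pairWeight τ u v ≠ 0 ↔ u ≠ v ∧ u ∉ τ ∧ v ∉ τ ∧ insert u (insert v τ) ∈ X.faces := by
  unfold pairWeight
  split_ifs with h
  · simp [h]
  · rw [linkWeight_ne_zero, mem_insert, not_or]
    tauto

theorem pairWeight_nonneg (τ : Finset V) (u v : V) : 0 ≤ X.pairWeight τ u v := by
  unfold pairWeight
  split_ifs
  · exact le_rfl
  · exact linkWeight_nonneg _ _

theorem pairWeight_symm (τ : Finset V) (u v : V) : X.pairWeight τ u v = X.pairWeight τ v u := by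
  by_cases h : u ≠ v ∧ u ∉ τ ∧ v ∉ τ ∧ insert u (insert v τ) ∈ X.faces
  · obtain ⟨h1, h2, h3, -⟩ := h
    simp [pairWeight, linkWeight, h2, h3, h1, h1.symm, Finset.insert_comm u v]
  · have h' : ¬(v ≠ u ∧ v ∉ τ ∧ u ∉ τ ∧ insert v (insert u τ) ∈ X.faces) := by
      rw [Finset.insert_comm v u, ne_comm]
      tauto
    rw [← pairWeight_ne_zero, not_not] at h h'
    rw [h, h']

theorem linkWeight_eq_zero_of_notMem_faces {τ : Finset V} (hτ : τ ∉ X.faces) (u : V) :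
    X.linkWeight τ u = 0 := by
  by_contra h
  exact hτ (X.down_closed _ (linkWeight_ne_zero.mp h).2 _ (subset_insert u τ))

theorem pairWeight_eq_zero_of_linkWeight {τ : Finset V} {u : V} (h : X.linkWeight τ u = 0) (v : V) :
    X.pairWeight τ v u = 0 := by
  by_contra h'
  obtain ⟨-, -, h2, h3⟩ := pairWeight_ne_zero.mp h'
  exact linkWeight_ne_zero.mpr ⟨h2, X.down_closed _ h3 _ (subset_insert _ _)⟩ h

theorem sum_linkWeight {n : ℕ} (hbal : X.IsBalanced n) (τ : Finset V) (hτ : τ.card ≤ n) :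
    ∑ u, X.linkWeight τ u = X.faceWeight τ := by
  by_cases hf : τ ∈ X.faces
  · have hw : X.faceWeight τ = X.weight τ := if_pos hf
    rw [hw, ← hbal τ hf hτ]
    have h1 : ∀ u, X.linkWeight τ u =
        if u ∉ τ ∧ insert u τ ∈ X.faces then X.weight (insert u τ) else 0 := by
      intro u
      unfold linkWeight faceWeight
      by_cases h : u ∈ τ <;> simp [h]
    simp_rw [h1]
    rw [← sum_filter]
    refine sum_bij (fun u _ => insert u τ) ?_ ?_ ?_ ?_
    · intro u hu
      simp only [mem_filter, mem_univ, true_and] at hu ⊢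
      exact ⟨hu.2, subset_insert _ _, card_insert_of_notMem hu.1⟩
    · intro u hu v hv huv
      simp only [mem_filter, mem_univ, true_and] at hu hv
      exact (insert_inj hu.1).mp huv
    · intro σ hσ
      simp only [mem_filter] at hσ
      obtain ⟨hσ, hs, hc⟩ := hσ
      obtain ⟨u, hu, rfl⟩ := (exists_eq_insert_iff (s := τ) (t := σ)).mpr ⟨hs, hc.symm⟩
      exact ⟨u, by simp [hu, hσ], rfl⟩
    · intro u _
      rfl
  · rw [faceWeight, if_neg hf]
    exact sum_eq_zero fun u _ => linkWeight_eq_zero_of_notMem_faces hf u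

theorem sum_pairWeight {n : ℕ} (hbal : X.IsBalanced n) (τ : Finset V) (hτ : τ.card + 1 ≤ n) (v : V) :
    ∑ u, X.pairWeight τ u v = X.linkWeight τ v := by
  unfold pairWeight
  by_cases hv : v ∈ τ
  · simp [hv, linkWeight]
  · simp only [hv, if_false]
    rw [sum_linkWeight hbal _ (by rwa [card_insert_of_notMem hv]), linkWeight, if_neg hv]

theorem sum_pairWeight_right {n : ℕ} (hbal : X.IsBalanced n) (τ : Finset V) (hτ : τ.card + 1 ≤ n)
    (u : V) : ∑ v, X.pairWeight τ u v = X.linkWeight τ u := by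
  rw [← sum_pairWeight hbal τ hτ]
  exact sum_congr rfl fun v _ => pairWeight_symm τ u v

/-- A colouring of the vertices such that the ends of each edge have different colours. -/
def IsColoring (X : WeightedComplex V) {ι : Type*} (col : V → ι) : Prop :=
  ∀ u v, u ≠ v → ({u, v} : Finset V) ∈ X.faces → col u ≠ col v

theorem IsPartite.exists_coloring {n : ℕ} {S : Fin (n + 1) → Finset V} (h : X.IsPartite n S) :
    ∃ col : V → Fin (n + 1), X.IsColoring col ∧ ∀ v j, {v} ∈ X.faces → (v ∈ S j ↔ col v = j) := by
  classical
  obtain ⟨h1, h2, h3⟩ := h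
  -- Elements of `V` that are not vertices get the colour `0`; they carry no weight, so the choice
  -- is harmless.
  let col : V → Fin (n + 1) := fun v => if h : ∃ j, v ∈ S j then h.choose else 0
  have hcol : ∀ v j, {v} ∈ X.faces → (v ∈ S j ↔ col v = j) := by
    intro v j hv
    have hex := (h1 v).mp hv
    have hc : v ∈ S (col v) := by
      simp only [col, dif_pos hex]
      exact hex.choose_spec
    constructor
    · intro hj
      by_contra hne
      exact disjoint_left.mp (h2 _ _ hne) hc hj
    · rintro rfl
      exact hc
  refine ⟨col, ?_, hcol⟩
  intro u v huv he
  obtain ⟨i, j, hij, hu, hv⟩ := h3 u v huv he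
  have hu' : {u} ∈ X.faces := X.down_closed _ he _ (by simp)
  have hv' : {v} ∈ X.faces := X.down_closed _ he _ (by simp)
  rw [(hcol u i hu').mp hu, (hcol v j hv').mp hv]
  exact hij

theorem IsColoring.injOn {ι : Type*} {col : V → ι} (h : X.IsColoring col) {σ : Finset V}
    (hσ : σ ∈ X.faces) : Set.InjOn col σ := by
  intro u hu v hv huv
  by_contra hne
  refine h u v hne (X.down_closed σ hσ _ ?_) huv
  intro x hx
  rcases mem_insert.mp hx with rfl | hx
  · exact hu
  · rw [mem_singleton.mp hx]
    exact hv

theorem IsColoring.notMem_image {ι : Type*} [DecidableEq ι] {col : V → ι} (h : X.IsColoring col)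
    {τ : Finset V} {v : V} (hv : X.linkWeight τ v ≠ 0) : col v ∉ τ.image col := by
  obtain ⟨h1, h2⟩ := linkWeight_ne_zero.mp hv
  intro hm
  obtain ⟨u, hu, huv⟩ := mem_image.mp hm
  exact h1 (h.injOn h2 (by simp [hu]) (by simp) huv ▸ hu)

/-- All colours missing from `τ` have the same share of the weight of the link of `τ`. -/
theorem IsColoring.sum_linkWeight_color {n : ℕ} {col : V → Fin (n + 1)} (h : X.IsColoring col)
    (hbal : X.IsBalanced n) (d : ℕ) (τ : Finset V) (hτ : τ ∈ X.faces) (hd : τ.card + d = n)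
    (j : Fin (n + 1)) (hj : j ∉ τ.image col) :
    ∑ v, (if col v = j then X.linkWeight τ v else 0) = X.faceWeight τ / (d + 1) := by
  induction d generalizing τ with
  | zero =>
    have hc : (τ.image col).card = n := by
      rw [card_image_of_injOn (h.injOn hτ)]
      exact hd
    -- Here `τ` uses `n` of the `n + 1` colours, so every vertex of its link has the remaining
    -- colour `j`.
    have huniv : insert j (τ.image col) = univ := by
      rw [← card_eq_iff_eq_univ, card_insert_of_notMem hj, hc, Fintype.card_fin]
    rw [Nat.cast_zero, zero_add, div_one, ← sum_linkWeight hbal τ (by omega)]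
    refine sum_congr rfl fun v _ => ?_
    split_ifs with hv
    · rfl
    · by_contra h0
      have h1 := h.notMem_image (Ne.symm h0)
      have h2 : col v ∈ insert j (τ.image col) := huniv ▸ mem_univ _
      rcases mem_insert.mp h2 with h3 | h3
      · exact hv h3
      · exact h1 h3
  | succ d ih =>
    set x := ∑ v, (if col v = j then X.linkWeight τ v else 0) with hx
    have hu : ∀ u, ∑ v, (if col v = j then X.pairWeight τ u v else 0) =
        if col u = j then 0 else X.linkWeight τ u / (d + 1) := by
      intro u
      by_cases h0 : X.linkWeight τ u = 0
      · simp only [h0, zero_div, ite_self]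
        exact sum_eq_zero fun v _ => by
          rw [pairWeight_symm, pairWeight_eq_zero_of_linkWeight h0, ite_self]
      obtain ⟨h1, h2⟩ := linkWeight_ne_zero.mp h0
      have hp : ∀ v, X.pairWeight τ u v = X.linkWeight (insert u τ) v := by
        intro v
        rw [pairWeight_symm, pairWeight, if_neg h1]
      simp_rw [hp]
      split_ifs with hc
      · refine sum_eq_zero fun v _ => ?_
        split_ifs with hv
        · by_contra h3
          exact h.notMem_image h3 (mem_image.mpr ⟨u, by simp, by rw [hc, hv]⟩)
        · rfl
      · rw [ih (insert u τ) h2 (by rw [card_insert_of_notMem h1]; omega)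
          (by rw [image_insert, mem_insert, not_or]; exact ⟨Ne.symm hc, hj⟩), linkWeight, if_neg h1]
    -- Count the edges into colour `j` from both ends: by balance at `v` they weigh `x`, and by
    -- induction in the links of the vertices `u` of other colours they weigh `(m(τ) - x)/(d + 1)`.
    -- Hence `x = m(τ)/(d + 2)`.
    have h1 : x = ∑ u, (if col u = j then 0 else X.linkWeight τ u / (d + 1)) := by
      simp_rw [← hu]
      rw [sum_comm, hx]
      refine sum_congr rfl fun v _ => ?_
      split_ifs
      · exact (sum_pairWeight hbal τ (by omega) v).symm
      · simp
    have h2 : ∑ u, (if col u = j then 0 else X.linkWeight τ u / (d + 1)) =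
        (X.faceWeight τ - x) / (d + 1) := by
      rw [← sum_linkWeight hbal τ (by omega), hx, ← sum_sub_distrib, sum_div]
      refine sum_congr rfl fun u _ => ?_
      split_ifs <;> simp
    rw [h2] at h1
    push_cast
    field_simp at h1 ⊢
    linarith

theorem IsColoring.partiteWeights {n : ℕ} {col : V → Fin (n + 1)} (h : X.IsColoring col)
    (hbal : X.IsBalanced n) {τ : Finset V} (hτ : τ ∈ X.faces) (hd : τ.card < n) :
    PartiteWeights (X.linkWeight τ) (X.pairWeight τ) col (univ \ τ.image col) (n - τ.card)
      (X.weight τ) where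
  N_pos := by omega
  card_colors := by
    rw [card_sdiff_of_subset (subset_univ _), card_univ, Fintype.card_fin,
      card_image_of_injOn (h.injOn hτ)]
    omega
  m_pos := X.weight_pos τ hτ
  nonneg := linkWeight_nonneg τ
  symm := pairWeight_symm τ
  proper u v huv := by
    by_contra h0
    obtain ⟨h1, -, -, h2⟩ := pairWeight_ne_zero.mp h0
    exact h1 (h.injOn h2 (by simp) (by simp) huv)
  col_mem v hv := by simpa using h.notMem_image hv
  sum_color j hj := by
    rw [h.sum_linkWeight_color hbal (n - τ.card) τ hτ (by omega) j (by simpa using hj), faceWeight,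
      if_pos hτ]
  sum_pair u j hj huj := by
    by_cases h0 : X.linkWeight τ u = 0
    · rw [h0, zero_div]
      exact sum_eq_zero fun v _ => by
        rw [pairWeight_symm, pairWeight_eq_zero_of_linkWeight h0, ite_self]
    obtain ⟨h1, h2⟩ := linkWeight_ne_zero.mp h0
    have hp : ∀ v, X.pairWeight τ u v = X.linkWeight (insert u τ) v := by
      intro v
      rw [pairWeight_symm, pairWeight, if_neg h1]
    simp_rw [hp]
    have hj' : j ∉ (insert u τ).image col := by
      rw [image_insert, mem_insert, not_or]
      exact ⟨huj.symm, by simpa using hj⟩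
    rw [h.sum_linkWeight_color hbal (n - τ.card - 1) (insert u τ) h2
      (by rw [card_insert_of_notMem h1]; omega) j hj', linkWeight, if_neg h1]
    congr 1
    have : n - τ.card = n - τ.card - 1 + 1 := by omega
    conv_rhs => rw [this]
    push_cast
    rfl
  pair_zero u v hv := pairWeight_eq_zero_of_linkWeight hv u

end WeightedComplex

/-! ### Cochains as functions of tuples, adjoints and Garland's formula -/

namespace WeightedComplex

open Finset

section Tuples

variable {V : Type*} [Fintype V]

theorem sum_tuple_cons {M : Type*} [AddCommMonoid M] {r : ℕ} (F : (Fin (r + 1) → V) → M) :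
    ∑ t, F t = ∑ v, ∑ t : Fin r → V, F (Fin.cons v t) := by
  rw [← Fintype.sum_prod_type' fun v (t : Fin r → V) => F (Fin.cons v t)]
  exact (Equiv.sum_comp (Fin.consEquiv fun _ => V) F).symm

/-- Alternating functions of tuples. -/
def IsAlternating {r : ℕ} (G : (Fin r → V) → ℝ) : Prop :=
  ∀ (t : Fin r → V) (π : Equiv.Perm (Fin r)), G (t ∘ π) = ((Equiv.Perm.sign π : ℤ) : ℝ) * G t

/-- Moving entry `i` to the front is a cycle of sign `(-1)^i`, which cancels the sign of the
differential. So all `r + 1` deletions contribute equally, which accounts for the quotient `(r + 1)!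
/ r!` in the inner products. -/
theorem IsAlternating.sum_mul_erase {r : ℕ} {G : (Fin (r + 1) → V) → ℝ} (hG : IsAlternating G)
    (c : V → ℝ) (H : (Fin r → V) → ℝ) (i : Fin (r + 1)) :
    ∑ t, G t * ((-1) ^ (i : ℕ) * (c (t i) * H (t ∘ i.succAbove))) =
      ∑ v, ∑ t, G (Fin.cons v t) * (c v * H t) := by
  have h0 : ∑ v, ∑ t, G (Fin.cons v t) * (c v * H t) =
      ∑ t, G t * (c (t 0) * H (Fin.tail t)) := by
    rw [sum_tuple_cons]
    simp
  rw [h0, ← Equiv.sum_comp (Equiv.arrowCongr i.cycleRange (Equiv.refl V))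
    fun t => G t * (c (t 0) * H (Fin.tail t))]
  refine sum_congr rfl fun t _ => ?_
  have h1 : (Equiv.arrowCongr i.cycleRange (Equiv.refl V)) t = t ∘ i.cycleRange.symm := rfl
  have h2 : Fin.tail (t ∘ i.cycleRange.symm) = t ∘ i.succAbove := by
    funext j
    simp [Fin.tail, Fin.cycleRange_symm_succ]
  have h3 : (t ∘ i.cycleRange.symm) 0 = t i := by simp [Fin.cycleRange_symm_zero]
  have h4 : ((Equiv.Perm.sign i.cycleRange.symm : ℤ) : ℝ) = (-1 : ℝ) ^ (i : ℕ) := by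
    simp [Equiv.Perm.sign_symm, Fin.sign_cycleRange]
  rw [h1, h2, h3, hG, h4]
  ring

theorem image_comp_perm {V : Type*} [DecidableEq V] {r : ℕ} (t : Fin r → V) (π : Equiv.Perm (Fin r)) :
    univ.image (t ∘ π) = univ.image t := by
  rw [← image_image, image_univ_equiv]

theorem image_tuple_cons {V : Type*} [DecidableEq V] {r : ℕ} (v : V) (t : Fin r → V) :
    univ.image (Fin.cons v t : Fin (r + 1) → V) = insert v (univ.image t) := by
  ext x
  simp [Fin.exists_fin_succ, eq_comm]

end Tuples

variable {V : Type*} [Fintype V] [DecidableEq V] (X : WeightedComplex V)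

/-- The weight of a tuple, zero if it is not an ordered simplex. -/
noncomputable def tupleWeight {r : ℕ} (t : Fin r → V) : ℝ :=
  open Classical in if Function.Injective t then X.faceWeight (univ.image t) else 0

variable {X}

/-- A cochain as a function of all tuples, zero outside the ordered simplices. -/
noncomputable def Cochain.onTuples {r : ℕ} (φ : X.Cochain r) (t : Fin r → V) : ℝ :=
  open Classical in
  if h : Function.Injective t ∧ univ.image t ∈ X.faces then φ.1 ⟨t, h⟩ else 0

theorem Cochain.onTuples_val {r : ℕ} (φ : X.Cochain r) (s : X.OrdSimplex r) :
    φ.onTuples s.1 = φ.1 s := dif_pos s.2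

theorem tupleWeight_val {r : ℕ} (s : X.OrdSimplex r) : X.tupleWeight s.1 = X.ordWeight s := by
  rw [tupleWeight, if_pos s.2.1, faceWeight, if_pos s.2.2, ordWeight]

theorem tupleWeight_ne_zero {r : ℕ} {t : Fin r → V} :
    X.tupleWeight t ≠ 0 ↔ Function.Injective t ∧ univ.image t ∈ X.faces := by
  unfold tupleWeight
  split_ifs with h
  · simp [h, faceWeight_ne_zero]
  · simp [h]

theorem tupleWeight_comp_perm {r : ℕ} (t : Fin r → V) (π : Equiv.Perm (Fin r)) :
    X.tupleWeight (t ∘ π) = X.tupleWeight t := by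
  unfold tupleWeight
  rw [image_comp_perm]
  simp only [Equiv.injective_comp]

theorem tupleWeight_cons {r : ℕ} (v : V) (t : Fin r → V) [Decidable (Function.Injective t)] :
    X.tupleWeight (Fin.cons v t : Fin (r + 1) → V) =
      if Function.Injective t then X.linkWeight (univ.image t) v else 0 := by
  unfold tupleWeight linkWeight
  rw [image_tuple_cons]
  simp only [Fin.cons_injective_iff]
  by_cases h : Function.Injective t <;> by_cases h' : v ∈ Set.range t <;> simp_all

theorem tupleWeight_cons_cons {r : ℕ} (u v : V) (t : Fin r → V)
    [Decidable (Function.Injective t)] :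
    X.tupleWeight (Fin.cons u (Fin.cons v t : Fin (r + 1) → V) : Fin (r + 2) → V) =
      if Function.Injective t then X.pairWeight (univ.image t) u v else 0 := by
  classical
  rw [tupleWeight_cons, image_tuple_cons]
  unfold pairWeight
  simp only [Fin.cons_injective_iff]
  by_cases h : Function.Injective t <;> by_cases h' : v ∈ Set.range t <;> simp_all

theorem tupleWeight_cons_ne_zero {r : ℕ} {v : V} {t : Fin r → V}
    (h : X.tupleWeight (Fin.cons v t : Fin (r + 1) → V) ≠ 0) : X.tupleWeight t ≠ 0 := by
  rw [tupleWeight_ne_zero] at h ⊢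
  rw [Fin.cons_injective_iff, image_tuple_cons] at h
  exact ⟨h.1.2, X.down_closed _ h.2 _ (subset_insert _ _)⟩

theorem tupleWeight_cons_comp_perm {r : ℕ} (v : V) (t : Fin r → V) (π : Equiv.Perm (Fin r)) :
    X.tupleWeight (Fin.cons v (t ∘ π) : Fin (r + 1) → V) =
      X.tupleWeight (Fin.cons v t : Fin (r + 1) → V) := by
  classical
  rw [tupleWeight_cons, tupleWeight_cons, image_comp_perm]
  simp only [Equiv.injective_comp]

theorem exists_ordSimplex {r : ℕ} {t : Fin r → V} (h : X.tupleWeight t ≠ 0) :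
    ∃ s : X.OrdSimplex r, s.1 = t := ⟨⟨t, tupleWeight_ne_zero.mp h⟩, rfl⟩

theorem sum_tupleWeight_mul {r : ℕ} (F : (Fin r → V) → ℝ) :
    ∑ t, X.tupleWeight t * F t = ∑ s : X.OrdSimplex r, X.ordWeight s * F s.1 := by
  classical
  have h1 : ∑ t ∈ univ.map ⟨fun s : X.OrdSimplex r => s.1, Subtype.val_injective⟩,
      X.tupleWeight t * F t = ∑ t, X.tupleWeight t * F t := by
    refine sum_subset (subset_univ _) fun t _ ht => ?_
    by_contra h
    apply ht
    have := tupleWeight_ne_zero.mp (left_ne_zero_of_mul h)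
    exact mem_map.mpr ⟨⟨t, this⟩, mem_univ _, rfl⟩
  rw [← h1, sum_map]
  exact sum_congr rfl fun s _ => by rw [← tupleWeight_val]; rfl

namespace Cochain

theorem isAlternating {r : ℕ} (φ : X.Cochain r) : IsAlternating φ.onTuples := by
  intro t π
  by_cases h : Function.Injective t ∧ univ.image t ∈ X.faces
  · obtain ⟨s, rfl⟩ : ∃ s : X.OrdSimplex r, s.1 = t := ⟨⟨t, h⟩, rfl⟩
    exact (φ.onTuples_val (s.permute π)).trans ((φ.2 s π).trans (by rw [φ.onTuples_val]))
  · have h' : ¬(Function.Injective (t ∘ π) ∧ univ.image (t ∘ π) ∈ X.faces) := by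
      rwa [image_comp_perm, Equiv.injective_comp]
    rw [onTuples, onTuples, dif_neg h, dif_neg h', mul_zero]

theorem inner_eq {r : ℕ} (φ ψ : X.Cochain r) :
    inner ℝ φ ψ = (∑ t, X.tupleWeight t * (φ.onTuples t * ψ.onTuples t)) / r.factorial := by
  rw [sum_tupleWeight_mul, sum_div]
  change ∑ s : X.OrdSimplex r, X.ordWeight s / (r.factorial : ℝ) * φ.1 s * ψ.1 s = _
  refine sum_congr rfl fun s _ => ?_
  rw [onTuples_val, onTuples_val]
  ring

end Cochain

/-- `D` is the differential in which the deletion of a vertex `v` has the extra factor `c v`. -/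
def IsWeightedDiff {r : ℕ} (c : V → ℝ) (D : X.Cochain r →ₗ[ℝ] X.Cochain (r + 1)) : Prop :=
  ∀ φ (s : X.OrdSimplex (r + 1)),
    (D φ).1 s = ∑ i : Fin (r + 1), (-1) ^ (i : ℕ) * (c (s.1 i) * φ.1 (s.erase i))

theorem isWeightedDiff_diff (r : ℕ) : IsWeightedDiff (fun _ => 1) (X.diff r) := by
  intro φ s
  simp only [one_mul]
  rfl

theorem isWeightedDiff_sideDiff {ι : Type*} [DecidableEq ι] {T : Finset V} {col : V → ι} {j : ι}
    (h : ∀ v, {v} ∈ X.faces → (v ∈ T ↔ col v = j)) (r : ℕ) :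
    IsWeightedDiff (fun v => if col v = j then 1 else 0) (X.sideDiff T r) := by
  intro φ s
  change (∑ i : Fin (r + 1), if s.1 i ∈ T then (-1 : ℝ) ^ (i : ℕ) * φ.1 (s.erase i) else 0) = _
  refine sum_congr rfl fun i _ => ?_
  have : {s.1 i} ∈ X.faces := X.down_closed _ s.2.2 _ (by simp)
  simp only [h _ this]
  split_ifs <;> simp

namespace IsWeightedDiff

variable {r : ℕ} {c : V → ℝ} {D : X.Cochain r →ₗ[ℝ] X.Cochain (r + 1)}

/-- The restriction to simplices is essential: off them the left side is zero by convention, while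
the alternating sum need not be. -/
theorem onTuples (hD : IsWeightedDiff c D) (φ : X.Cochain r) {t : Fin (r + 1) → V}
    (ht : X.tupleWeight t ≠ 0) :
    (D φ).onTuples t =
      ∑ i : Fin (r + 1), (-1) ^ (i : ℕ) * (c (t i) * φ.onTuples (t ∘ i.succAbove)) := by
  obtain ⟨s, rfl⟩ := exists_ordSimplex ht
  rw [Cochain.onTuples_val, hD]
  refine sum_congr rfl fun i _ => ?_
  rw [← φ.onTuples_val]
  rfl

theorem inner_eq (hD : IsWeightedDiff c D) (φ : X.Cochain r) (ψ : X.Cochain (r + 1)) :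
    inner ℝ (D φ) ψ = (∑ t : Fin r → V, ∑ v, X.tupleWeight (Fin.cons v t : Fin (r + 1) → V) *
      (c v * φ.onTuples t * ψ.onTuples (Fin.cons v t : Fin (r + 1) → V))) / r.factorial := by
  rw [Cochain.inner_eq]
  have hG : IsAlternating fun t => X.tupleWeight t * ψ.onTuples t := by
    intro t π
    simp only
    rw [tupleWeight_comp_perm, ψ.isAlternating]
    ring
  have h1 : ∀ t : Fin (r + 1) → V, X.tupleWeight t * ((D φ).onTuples t * ψ.onTuples t) =
      ∑ i : Fin (r + 1), X.tupleWeight t * ψ.onTuples t *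
        ((-1) ^ (i : ℕ) * (c (t i) * φ.onTuples (t ∘ i.succAbove))) := by
    intro t
    by_cases ht : X.tupleWeight t = 0
    · simp [ht]
    · rw [hD.onTuples φ ht, ← mul_sum]
      ring
  simp_rw [h1]
  rw [sum_comm]
  simp_rw [hG.sum_mul_erase c φ.onTuples]
  rw [sum_const, card_univ, Fintype.card_fin, nsmul_eq_mul, Nat.factorial_succ, sum_comm]
  have h2 : ((r + 1 : ℕ) : ℝ) ≠ 0 := by positivity
  push_cast at h2 ⊢
  rw [mul_div_mul_left _ _ h2]
  congr 1
  exact sum_congr rfl fun t _ => sum_congr rfl fun v _ => by ring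

/-- The value of the adjoint of a weighted differential. -/
noncomputable def codiff (c : V → ℝ) (ψ : X.Cochain (r + 1)) : X.Cochain r :=
  ⟨fun s => ∑ v, X.tupleWeight (Fin.cons v s.1 : Fin (r + 1) → V) *
      (c v * ψ.onTuples (Fin.cons v s.1 : Fin (r + 1) → V)) / X.tupleWeight s.1, by
    intro s π
    rw [mul_sum]
    refine sum_congr rfl fun v _ => ?_
    have hs : (s.permute π).1 = s.1 ∘ π := rfl
    -- The permutation fixing `0` and acting as `π` on the other places; it has the sign of `π`.
    let κ : Equiv.Perm (Fin (r + 1)) := Equiv.Perm.decomposeFin.symm (0, π)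
    have hκ : (Fin.cons v (s.1 ∘ π) : Fin (r + 1) → V) = (Fin.cons v s.1 : Fin (r + 1) → V) ∘ κ := by
      funext j
      refine Fin.cases ?_ (fun j => ?_) j <;> simp [κ]
    have hsign : Equiv.Perm.sign κ = Equiv.Perm.sign π := by simp [κ]
    rw [hs, tupleWeight_cons_comp_perm, tupleWeight_comp_perm, hκ, ψ.isAlternating, hsign]
    ring⟩

/-- Multiplying by the weight of `t` clears the denominator, so that the formula also holds, as `0 =
0`, off the simplices. -/
theorem codiff_onTuples (c : V → ℝ) (ψ : X.Cochain (r + 1)) (t : Fin r → V) :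
    X.tupleWeight t * (codiff c ψ).onTuples t =
      ∑ v, X.tupleWeight (Fin.cons v t : Fin (r + 1) → V) *
        (c v * ψ.onTuples (Fin.cons v t : Fin (r + 1) → V)) := by
  by_cases ht : X.tupleWeight t = 0
  · rw [ht, zero_mul]
    refine (sum_eq_zero fun v _ => ?_).symm
    have : X.tupleWeight (Fin.cons v t : Fin (r + 1) → V) = 0 := by
      by_contra h
      exact tupleWeight_cons_ne_zero h ht
    rw [this, zero_mul]
  · obtain ⟨s, rfl⟩ := exists_ordSimplex ht
    rw [Cochain.onTuples_val]
    change _ * ∑ v, _ / _ = _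
    rw [← sum_div, mul_div_cancel₀ _ ht]

theorem adjoint_apply (hD : IsWeightedDiff c D) (ψ : X.Cochain (r + 1)) :
    LinearMap.adjoint D ψ = codiff c ψ := by
  refine ext_inner_left ℝ fun φ => ?_
  rw [LinearMap.adjoint_inner_right, hD.inner_eq, Cochain.inner_eq]
  congr 1
  refine sum_congr rfl fun t _ => ?_
  have : X.tupleWeight t * (φ.onTuples t * (codiff c ψ).onTuples t) =
      φ.onTuples t * (X.tupleWeight t * (codiff c ψ).onTuples t) := by ring
  rw [this, codiff_onTuples, mul_sum]
  exact sum_congr rfl fun v _ => by ring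

theorem inner_comp_adjoint (hD : IsWeightedDiff c D) (ψ : X.Cochain (r + 1)) :
    inner ℝ ((D ∘ₗ LinearMap.adjoint D) ψ) ψ =
      (∑ t : Fin r → V, (∑ v, X.tupleWeight (Fin.cons v t : Fin (r + 1) → V) *
        (c v * ψ.onTuples (Fin.cons v t : Fin (r + 1) → V))) ^ 2 / X.tupleWeight t) /
          r.factorial := by
  rw [LinearMap.comp_apply, ← LinearMap.adjoint_inner_right, hD.adjoint_apply, Cochain.inner_eq]
  congr 1
  refine sum_congr rfl fun t _ => ?_
  rw [← codiff_onTuples]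
  by_cases ht : X.tupleWeight t = 0
  · simp [ht]
  · field_simp

end IsWeightedDiff

open Classical in
/-- Garland's formula: the upper Laplacian in terms of the links. -/
theorem inner_diff_diff {k : ℕ} (hbal : ∀ t : Fin (k + 1) → V,
      ∑ v, X.tupleWeight (Fin.cons v t : Fin (k + 2) → V) = X.tupleWeight t)
    (φ ψ : X.Cochain (k + 1)) :
    inner ℝ (X.diff (k + 1) φ) (X.diff (k + 1) ψ) = inner ℝ φ ψ -
      (∑ t : Fin k → V, if Function.Injective t then
        ∑ u, ∑ v, X.pairWeight (univ.image t) u v *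
          (φ.onTuples (Fin.cons u t : Fin (k + 1) → V) *
            ψ.onTuples (Fin.cons v t : Fin (k + 1) → V)) else 0) / k.factorial := by
  have hd := isWeightedDiff_diff (X := X) (k + 1)
  -- Deleting the new vertex `v` gives the diagonal term, which becomes `⟨φ, ψ⟩` by balance; the
  -- other deletions keep `v` and give the edges of links.
  have h1 : ∀ (t : Fin (k + 1) → V) v, X.tupleWeight (Fin.cons v t : Fin (k + 2) → V) *
      (1 * φ.onTuples t * (X.diff (k + 1) ψ).onTuples (Fin.cons v t : Fin (k + 2) → V)) =
      X.tupleWeight (Fin.cons v t : Fin (k + 2) → V) * (φ.onTuples t * ψ.onTuples t) -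
      ∑ i : Fin (k + 1), X.tupleWeight (Fin.cons v t : Fin (k + 2) → V) * φ.onTuples t *
        ((-1) ^ (i : ℕ) * (1 * ψ.onTuples (Fin.cons v (t ∘ i.succAbove) : Fin (k + 1) → V))) := by
    intro t v
    by_cases ht : X.tupleWeight (Fin.cons v t : Fin (k + 2) → V) = 0
    · simp [ht]
    rw [hd.onTuples ψ ht, Fin.sum_univ_succ, ← mul_sum]
    have h2 : ((Fin.cons v t : Fin (k + 2) → V) ∘ (0 : Fin (k + 2)).succAbove) = t := by
      funext j
      simp
    have h3 : ∀ i : Fin (k + 1), ((Fin.cons v t : Fin (k + 2) → V) ∘ i.succ.succAbove) =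
        Fin.cons v (t ∘ i.succAbove) := by
      intro i
      funext j
      refine Fin.cases ?_ (fun j => ?_) j <;> simp
    simp_rw [h2, h3]
    simp only [Fin.val_zero, pow_zero, Fin.val_succ, pow_succ, mul_neg, mul_one, one_mul, neg_mul,
      sum_neg_distrib]
    ring
  have hG : ∀ v, IsAlternating fun t : Fin (k + 1) → V =>
      X.tupleWeight (Fin.cons v t : Fin (k + 2) → V) * φ.onTuples t := by
    intro v t π
    simp only
    rw [tupleWeight_cons_comp_perm, φ.isAlternating]
    ring
  rw [hd.inner_eq, Cochain.inner_eq]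
  simp_rw [h1, sum_sub_distrib, ← sum_mul, hbal]
  rw [sub_div]
  congr 1
  rw [sum_comm]
  -- With `v` fixed in front, the weight times `φ` still alternates in `t`, so the `k + 1` deletions
  -- agree and reduce `(k + 1)!` to `k!`.
  have h4 : ∀ v, ∑ t : Fin (k + 1) → V, ∑ i : Fin (k + 1),
      X.tupleWeight (Fin.cons v t : Fin (k + 2) → V) * φ.onTuples t *
        ((-1) ^ (i : ℕ) * (1 * ψ.onTuples (Fin.cons v (t ∘ i.succAbove) : Fin (k + 1) → V))) =
      (k + 1 : ℕ) * ∑ u, ∑ t : Fin k → V,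
        X.tupleWeight (Fin.cons v (Fin.cons u t : Fin (k + 1) → V) : Fin (k + 2) → V) *
          φ.onTuples (Fin.cons u t : Fin (k + 1) → V) *
          (1 * ψ.onTuples (Fin.cons v t : Fin (k + 1) → V)) := by
    intro v
    rw [sum_comm]
    have := (hG v).sum_mul_erase (fun _ => 1)
      fun t => ψ.onTuples (Fin.cons v t : Fin (k + 1) → V)
    simp_rw [this]
    rw [sum_const, card_univ, Fintype.card_fin, nsmul_eq_mul]
  simp_rw [h4]
  rw [← mul_sum, Nat.factorial_succ, Nat.cast_mul, mul_div_mul_left _ _ (by positivity)]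
  congr 1
  simp_rw [sum_comm (s := (univ : Finset V)) (t := (univ : Finset (Fin k → V)))]
  refine sum_congr rfl fun t _ => ?_
  simp_rw [tupleWeight_cons_cons]
  split_ifs
  · rw [sum_comm]
    refine sum_congr rfl fun u _ => sum_congr rfl fun v _ => ?_
    rw [pairWeight_symm]
    ring
  · simp

end WeightedComplex

/-! ### Spectral gaps of links and their descent -/

namespace WeightedComplex

open Finset

variable {V : Type*} [Fintype V] [DecidableEq V] {X : WeightedComplex V}

theorem faceWeight_link {τ : Finset V} (hτ : τ ∈ X.faces) (σ : Finset V) :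
    (X.link τ hτ).faceWeight σ = if Disjoint τ σ then X.faceWeight (τ ∪ σ) else 0 := by
  have hmem : σ ∈ (X.link τ hτ).faces ↔ Disjoint τ σ ∧ τ ∪ σ ∈ X.faces := by
    change σ ∈ X.faces.filter _ ↔ _
    rw [mem_filter]
    exact ⟨fun h => h.2, fun h => ⟨X.down_closed _ h.2 _ subset_union_right, h⟩⟩
  unfold faceWeight
  simp only [hmem]
  by_cases h1 : Disjoint τ σ <;> by_cases h2 : τ ∪ σ ∈ X.faces <;> simp [h1, h2, link]

theorem linkWeight_link {τ : Finset V} (hτ : τ ∈ X.faces) (u : V) :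
    (X.link τ hτ).linkWeight ∅ u = X.linkWeight τ u := by
  unfold linkWeight
  rw [faceWeight_link]
  by_cases h : u ∈ τ <;> simp [h]

theorem pairWeight_link {τ : Finset V} (hτ : τ ∈ X.faces) (u v : V) :
    (X.link τ hτ).pairWeight ∅ u v = X.pairWeight τ u v := by
  unfold pairWeight linkWeight
  rw [faceWeight_link]
  by_cases h1 : u ∈ τ <;> by_cases h2 : v ∈ τ <;> by_cases h3 : u = v <;>
    simp [h1, h2, h3, union_insert]

/-- The values of a `0`-cochain on the vertices. -/
noncomputable def Cochain.vertexValue (φ : X.Cochain 1) (v : V) : ℝ :=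
  φ.onTuples (Fin.cons v (default : Fin 0 → V) : Fin 1 → V)

/-- The `0`-cochain given by a function on `V`. -/
def Cochain.ofFun (X : WeightedComplex V) (g : V → ℝ) : X.Cochain 1 :=
  ⟨fun s => g (s.1 0), by
    intro s π
    rw [Subsingleton.elim π 1]
    simp [OrdSimplex.permute]⟩

theorem tupleWeight_link {τ : Finset V} (hτ : τ ∈ X.faces) (v : V) (t : Fin 0 → V) :
    (X.link τ hτ).tupleWeight (Fin.cons v t : Fin 1 → V) = X.linkWeight τ v := by
  classical
  rw [tupleWeight_cons, if_pos (Function.injective_of_subsingleton t), ← linkWeight_link hτ]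
  congr 1

theorem Cochain.vertexValue_ofFun {τ : Finset V} (hτ : τ ∈ X.faces) (g : V → ℝ) {v : V}
    (hv : X.linkWeight τ v ≠ 0) : (ofFun (X.link τ hτ) g).vertexValue v = g v := by
  rw [← tupleWeight_link hτ v default] at hv
  obtain ⟨s, hs⟩ := exists_ordSimplex hv
  rw [vertexValue, ← hs, onTuples_val]
  change g (s.1 0) = g v
  rw [hs, Fin.cons_zero]

theorem inner_link {τ : Finset V} (hτ : τ ∈ X.faces) (φ ψ : (X.link τ hτ).Cochain 1) :
    inner ℝ φ ψ = ∑ v, X.linkWeight τ v * (φ.vertexValue v * ψ.vertexValue v) := by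
  rw [Cochain.inner_eq, sum_tuple_cons]
  simp only [Nat.factorial_one, Nat.cast_one, div_one, Fintype.sum_unique, tupleWeight_link]
  rfl

theorem inner_upperLaplacian_link {n : ℕ} (hbal : X.IsBalanced n) {τ : Finset V}
    (hτ : τ ∈ X.faces) (hn : τ.card + 1 ≤ n) (φ ψ : (X.link τ hτ).Cochain 1) :
    inner ℝ ((X.link τ hτ).upperLaplacian 0 φ) ψ =
      ∑ v, X.linkWeight τ v * (φ.vertexValue v * ψ.vertexValue v) -
      ∑ u, ∑ v, X.pairWeight τ u v * (φ.vertexValue u * ψ.vertexValue v) := by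
  classical
  rw [upperLaplacian, LinearMap.comp_apply, LinearMap.adjoint_inner_left,
    inner_diff_diff (k := 0) ?_, inner_link]
  · simp only [Nat.factorial_zero, Nat.cast_one, div_one, Fintype.sum_unique,
      if_pos (Function.injective_of_subsingleton (default : Fin 0 → V))]
    have : univ.image (default : Fin 0 → V) = ∅ := by simp
    simp_rw [this, pairWeight_link]
    rfl
  · intro t
    obtain ⟨u, t', rfl⟩ : ∃ u, ∃ t' : Fin 0 → V, t = Fin.cons u t' :=
      ⟨t 0, Fin.tail t, (Fin.cons_self_tail t).symm⟩
    have : univ.image t' = ∅ := by simp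
    simp_rw [tupleWeight_cons_cons, if_pos (Function.injective_of_subsingleton t'), this,
      pairWeight_link, tupleWeight_link]
    exact sum_pairWeight hbal τ hn u

/-- The upper Laplacian of the link of `τ` is at least `c` on functions orthogonal to the
constants. -/
def HasGap (X : WeightedComplex V) (τ : Finset V) (c : ℝ) : Prop :=
  ∀ g : V → ℝ, ∑ v, X.linkWeight τ v * g v = 0 →
    ∑ u, ∑ v, X.pairWeight τ u v * (g u * g v) ≤ (1 - c) * ∑ v, X.linkWeight τ v * g v ^ 2

/-- The Dirichlet form of the link. It shows both that functions in the kernel of the Laplacian are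
constant along edges and that eigenvalues are nonnegative. -/
theorem sum_pairWeight_sub_sq {n : ℕ} (hbal : X.IsBalanced n) {τ : Finset V}
    (hn : τ.card + 1 ≤ n) (g : V → ℝ) :
    ∑ u, ∑ v, X.pairWeight τ u v * (g u - g v) ^ 2 =
      2 * (∑ v, X.linkWeight τ v * (g v * g v) - ∑ u, ∑ v, X.pairWeight τ u v * (g u * g v)) := by
  have h1 : ∑ u, ∑ v, X.pairWeight τ u v * (g v * g v) =
      ∑ v, X.linkWeight τ v * (g v * g v) := by
    rw [sum_comm]
    simp_rw [← sum_mul, sum_pairWeight hbal τ hn]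
  have h2 : ∑ u, ∑ v, X.pairWeight τ u v * (g u * g u) =
      ∑ v, X.linkWeight τ v * (g v * g v) := by
    rw [← h1, sum_comm]
    simp_rw [pairWeight_symm (X := X) τ]
  rw [mul_sub, two_mul]
  nth_rw 1 [← h2]
  rw [← h1, mul_sum]
  simp_rw [mul_sum, ← sum_add_distrib, ← sum_sub_distrib]
  exact sum_congr rfl fun u _ => sum_congr rfl fun v _ => by ring

/-- By connectedness the kernel of the Laplacian consists of the constants, so orthogonality to
constants is orthogonality to the kernel. -/
theorem hasGap_of_spectrum {n : ℕ} (hbal : X.IsBalanced n) {τ : Finset V}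
    (hτ : τ ∈ X.faces) (hn : τ.card + 1 ≤ n) (hconn : (X.link τ hτ).oneSkeleton.Connected) {c : ℝ}
    (hc : ∀ t ∈ spectrum ℝ ((X.link τ hτ).upperLaplacian 0), t ≠ 0 → c ≤ t) :
    X.HasGap τ c := by
  intro g hg
  have hsymm : LinearMap.IsSymmetric ((X.link τ hτ).upperLaplacian 0) :=
    LinearMap.isSymmetric_adjoint_comp_self _
  have hval : ∀ v, X.linkWeight τ v * (Cochain.ofFun (X.link τ hτ) g).vertexValue v =
      X.linkWeight τ v * g v := by
    intro v
    by_cases hv : X.linkWeight τ v = 0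
    · simp [hv]
    · rw [Cochain.vertexValue_ofFun hτ g hv]
  have key := hsymm.le_inner_apply_of_eigenvalues hc (x := Cochain.ofFun (X.link τ hτ) g) ?_
  · rw [inner_upperLaplacian_link hbal hτ hn, inner_link] at key
    have h1 : ∀ v, X.linkWeight τ v * ((Cochain.ofFun (X.link τ hτ) g).vertexValue v *
        (Cochain.ofFun (X.link τ hτ) g).vertexValue v) = X.linkWeight τ v * g v ^ 2 := by
      intro v
      by_cases hv : X.linkWeight τ v = 0
      · simp [hv]
      · rw [Cochain.vertexValue_ofFun hτ g hv, sq]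
    have h2 : ∀ u v, X.pairWeight τ u v * ((Cochain.ofFun (X.link τ hτ) g).vertexValue u *
        (Cochain.ofFun (X.link τ hτ) g).vertexValue v) = X.pairWeight τ u v * (g u * g v) := by
      intro u v
      by_cases hv : X.linkWeight τ v = 0
      · simp [pairWeight_eq_zero_of_linkWeight hv]
      by_cases hu : X.linkWeight τ u = 0
      · simp [pairWeight_symm τ u, pairWeight_eq_zero_of_linkWeight hu]
      · rw [Cochain.vertexValue_ofFun hτ g hv, Cochain.vertexValue_ofFun hτ g hu]
    simp_rw [h1, h2] at key
    linarith
  · intro φ hφ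
    have h0 := inner_upperLaplacian_link hbal hτ hn φ φ
    rw [hφ, inner_zero_left] at h0
    have hsq := sum_pairWeight_sub_sq hbal hn φ.vertexValue
    rw [← h0, mul_zero] at hsq
    -- The Dirichlet form of a kernel element is a vanishing sum of nonnegative terms.
    have hadj : ∀ u v, X.pairWeight τ u v ≠ 0 → φ.vertexValue u = φ.vertexValue v := by
      intro u v huv
      have hnn : ∀ u v, 0 ≤ X.pairWeight τ u v * (φ.vertexValue u - φ.vertexValue v) ^ 2 :=
        fun u v => mul_nonneg (pairWeight_nonneg _ _ _) (sq_nonneg _)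
      have h1 := (sum_eq_zero_iff_of_nonneg fun u _ => sum_nonneg fun v _ => hnn u v).mp hsq u
        (mem_univ u)
      have h2 := (sum_eq_zero_iff_of_nonneg fun v _ => hnn u v).mp h1 v (mem_univ v)
      have h3 := (mul_eq_zero.mp h2).resolve_left huv
      exact sub_eq_zero.mp (pow_eq_zero_iff two_ne_zero |>.mp h3)
    have hmem : ∀ u v, u ≠ v → ({u, v} : Finset V) ∈ (X.link τ hτ).faces →
        X.pairWeight τ u v ≠ 0 := by
      intro u v huv h
      rw [← pairWeight_link hτ, pairWeight_ne_zero]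
      exact ⟨huv, notMem_empty _, notMem_empty _, h⟩
    have hwalk : ∀ a b : {v : V // {v} ∈ (X.link τ hτ).faces},
        φ.vertexValue a = φ.vertexValue b := by
      intro a b
      obtain ⟨p⟩ := hconn.preconnected a b
      induction p with
      | nil => rfl
      | cons hab _ ih =>
        rw [← ih]
        exact hadj _ _ (hmem _ _ (fun h => hab.1 (Subtype.ext h)) hab.2)
    rw [inner_link]
    obtain ⟨a⟩ := hconn.nonempty
    have hterm : ∀ v, X.linkWeight τ v * (φ.vertexValue v *
        (Cochain.ofFun (X.link τ hτ) g).vertexValue v) =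
        φ.vertexValue a * (X.linkWeight τ v * g v) := by
      intro v
      by_cases hv : X.linkWeight τ v = 0
      · simp [hv]
      · have hv' : {v} ∈ (X.link τ hτ).faces := by
          rw [← linkWeight_link hτ] at hv
          exact (linkWeight_ne_zero.mp hv).2
        rw [hwalk ⟨v, hv'⟩ a, ← hval]
        ring
    simp_rw [hterm]
    rw [← mul_sum, hg, mul_zero]

theorem sum_pairWeight_insert {n : ℕ} (hbal : X.IsBalanced n) {τ : Finset V}
    (hn : τ.card + 2 ≤ n) (a b : V) :
    ∑ v, (if v ∈ τ then 0 else X.pairWeight (insert v τ) a b) = X.pairWeight τ a b := by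
  have h1 : ∀ v, (if v ∈ τ then 0 else X.pairWeight (insert v τ) a b) =
      if b ∈ τ then 0 else X.pairWeight (insert b τ) a v := by
    intro v
    unfold pairWeight
    rw [Finset.insert_comm b v]
    by_cases hv : v ∈ τ <;> by_cases hb : b ∈ τ <;> by_cases hbv : b = v <;>
      simp [hv, hb, hbv, Ne.symm]
  simp_rw [h1]
  rw [pairWeight]
  split_ifs with hb
  · simp
  · simp_rw [pairWeight_symm (X := X) (insert b τ) a]
    exact sum_pairWeight hbal _ (by rw [card_insert_of_notMem hb]; omega) a

/-- Spectral descent: a gap of all vertex links gives a gap of the complex. -/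
theorem le_of_mem_spectrum_link {n : ℕ} (hbal : X.IsBalanced n) {τ : Finset V}
    (hτ : τ ∈ X.faces) (hn : τ.card + 2 ≤ n) {c : ℝ} (hc0 : 0 < c)
    (hgap : ∀ v, v ∉ τ → insert v τ ∈ X.faces → X.HasGap (insert v τ) c)
    {t : ℝ} (ht : t ∈ spectrum ℝ ((X.link τ hτ).upperLaplacian 0)) (ht0 : t ≠ 0) :
    gapMap c ≤ t := by
  obtain ⟨φ, hφ⟩ := (Module.End.hasEigenvalue_iff_mem_spectrum.mpr ht).exists_hasEigenvector
  have hφ1 : (X.link τ hτ).upperLaplacian 0 φ = t • φ := hφ.apply_eq_smul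
  set g := φ.vertexValue with hg
  set Q := ∑ v, X.linkWeight τ v * (g v * g v) with hQ
  have hQ0 : 0 < Q := by
    have : inner ℝ φ φ = Q := inner_link hτ φ φ
    rw [← this]
    exact real_inner_self_pos.mpr hφ.2
  have hB : ∑ u, ∑ v, X.pairWeight τ u v * (g u * g v) = (1 - t) * Q := by
    have h1 := inner_upperLaplacian_link hbal hτ (by omega) φ φ
    rw [hφ1, real_inner_smul_left, inner_link] at h1
    linarith
  have hM : ∀ v, ∑ u, X.pairWeight τ u v * g u = (1 - t) * (X.linkWeight τ v * g v) := by
    intro v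
    by_cases hv : X.linkWeight τ v = 0
    · simp [hv, pairWeight_eq_zero_of_linkWeight hv]
    -- Test the eigenvalue equation against the point mass at `v`: the mean of `g` over the link of
    -- `v` is `(1 - t) g(v)`.
    have h1 := inner_upperLaplacian_link hbal hτ (by omega) φ
      (Cochain.ofFun (X.link τ hτ) (Pi.single v 1))
    rw [hφ1, real_inner_smul_left, inner_link] at h1
    have h2 : ∀ x, X.linkWeight τ x * (g x *
        (Cochain.ofFun (X.link τ hτ) (Pi.single v 1)).vertexValue x) =
        if v = x then X.linkWeight τ x * g x else 0 := by
      intro x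
      by_cases hx : X.linkWeight τ x = 0
      · simp [hx]
      · rw [Cochain.vertexValue_ofFun hτ _ hx, Pi.single_apply]
        simp only [eq_comm (a := x)]
        split_ifs <;> simp
    have h3 : ∀ u x, X.pairWeight τ u x * (g u *
        (Cochain.ofFun (X.link τ hτ) (Pi.single v 1)).vertexValue x) =
        if v = x then X.pairWeight τ u x * g u else 0 := by
      intro u x
      by_cases hx : X.linkWeight τ x = 0
      · simp [pairWeight_eq_zero_of_linkWeight hx]
      · rw [Cochain.vertexValue_ofFun hτ _ hx, Pi.single_apply]
        simp only [eq_comm (a := x)]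
        split_ifs <;> simp
    rw [← hg] at h1
    simp_rw [h2, h3] at h1
    simp only [sum_ite_eq, mem_univ, if_true] at h1
    linarith
  have htpos : 0 < t := by
    have h1 := sum_pairWeight_sub_sq hbal (τ := τ) (by omega) g
    rw [hB, ← hQ] at h1
    have h2 : 0 ≤ ∑ u, ∑ v, X.pairWeight τ u v * (g u - g v) ^ 2 :=
      sum_nonneg fun u _ => sum_nonneg fun v _ =>
        mul_nonneg (pairWeight_nonneg _ _ _) (sq_nonneg _)
    rw [h1] at h2
    have h3 : 0 ≤ t * Q := by linarith
    exact lt_of_le_of_ne (nonneg_of_mul_nonneg_left h3 hQ0) (Ne.symm ht0)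
  -- The gap in the link of `v`, applied to `g` minus its mean `(1 - t) g(v)` there.
  have hv : ∀ v, ∑ a, ∑ b, (if v ∈ τ then 0 else X.pairWeight (insert v τ) a b) * (g a * g b) -
      (1 - t) ^ 2 * (X.linkWeight τ v * (g v * g v)) ≤
      (1 - c) * (∑ a, X.pairWeight τ a v * (g a * g a) -
        (1 - t) ^ 2 * (X.linkWeight τ v * (g v * g v))) := by
    intro v
    by_cases hv : X.linkWeight τ v = 0
    · have h1 : ∀ a b, (if v ∈ τ then 0 else X.pairWeight (insert v τ) a b) = 0 := by
        intro a b
        split_ifs with hvτ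
        · rfl
        · by_contra h
          obtain ⟨-, -, -, h3⟩ := pairWeight_ne_zero.mp h
          refine linkWeight_ne_zero.mpr ⟨hvτ, X.down_closed _ h3 _ ?_⟩ hv
          exact (subset_insert _ _).trans (subset_insert _ _)
      simp [h1, hv, pairWeight_eq_zero_of_linkWeight hv]
    obtain ⟨hvτ, hvf⟩ := linkWeight_ne_zero.mp hv
    have hp : ∀ a, X.linkWeight (insert v τ) a = X.pairWeight τ a v := by
      intro a
      rw [pairWeight, if_neg hvτ]
    set q := (1 - t) * g v with hq
    have h0 : ∑ a, X.linkWeight (insert v τ) a * (g a - q) = 0 := by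
      simp_rw [hp, mul_sub, sum_sub_distrib, hM, ← sum_mul, sum_pairWeight hbal τ (by omega : _ ≤ n)]
      ring
    have h1 := hgap v hvτ hvf _ h0
    simp only [if_neg hvτ]
    have hcard : (insert v τ).card + 1 ≤ n := by rw [card_insert_of_notMem hvτ]; omega
    have hMv := hM v
    have hsv := sum_pairWeight hbal τ (by omega : _ ≤ n) v
    have e1 : ∑ a, ∑ b, X.pairWeight (insert v τ) a b * ((g a - q) * (g b - q)) =
        ∑ a, ∑ b, X.pairWeight (insert v τ) a b * (g a * g b) -
          q ^ 2 * X.linkWeight τ v := by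
      have e2 : ∑ a, ∑ b, X.pairWeight (insert v τ) a b * g b = q * X.linkWeight τ v := by
        rw [sum_comm]
        simp_rw [← sum_mul, sum_pairWeight hbal _ hcard, hp]
        rw [hMv, hq]
        ring
      have e3 : ∑ a, ∑ b, X.pairWeight (insert v τ) a b * g a = q * X.linkWeight τ v := by
        rw [← e2, sum_comm]
        simp_rw [pairWeight_symm (X := X) (insert v τ)]
      have e4 : ∑ a, ∑ b, X.pairWeight (insert v τ) a b = X.linkWeight τ v := by
        rw [sum_comm]
        simp_rw [sum_pairWeight hbal _ hcard, hp]
        exact hsv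
      have e5 : ∀ a b, X.pairWeight (insert v τ) a b * ((g a - q) * (g b - q)) =
          X.pairWeight (insert v τ) a b * (g a * g b) - q * (X.pairWeight (insert v τ) a b * g a) -
          q * (X.pairWeight (insert v τ) a b * g b) + q ^ 2 * X.pairWeight (insert v τ) a b := by
        intro a b
        ring
      simp_rw [e5, sum_add_distrib, sum_sub_distrib, ← mul_sum]
      rw [e2, e3, e4]
      ring
    have e6 : ∑ a, X.linkWeight (insert v τ) a * (g a - q) ^ 2 =
        ∑ a, X.pairWeight τ a v * (g a * g a) - q ^ 2 * X.linkWeight τ v := by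
      have e7 : ∀ a, X.linkWeight (insert v τ) a * (g a - q) ^ 2 =
          X.pairWeight τ a v * (g a * g a) - 2 * q * (X.pairWeight τ a v * g a) +
          q ^ 2 * X.pairWeight τ a v := by
        intro a
        rw [hp]
        ring
      simp_rw [e7, sum_add_distrib, sum_sub_distrib, ← mul_sum]
      rw [hMv, hsv, hq]
      ring
    rw [e1, e6] at h1
    have e8 : q ^ 2 * X.linkWeight τ v = (1 - t) ^ 2 * (X.linkWeight τ v * (g v * g v)) := by
      rw [hq]; ring
    rwa [e8] at h1
  have hsum := sum_le_sum fun v (_ : v ∈ univ) => hv v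
  rw [← mul_sum, sum_sub_distrib, sum_sub_distrib, ← mul_sum, ← hQ] at hsum
  have s1 : ∑ v, ∑ a, ∑ b, (if v ∈ τ then 0 else X.pairWeight (insert v τ) a b) * (g a * g b) =
      (1 - t) * Q := by
    rw [sum_comm, ← hB]
    refine sum_congr rfl fun a _ => ?_
    rw [sum_comm]
    refine sum_congr rfl fun b _ => ?_
    rw [← sum_mul, sum_pairWeight_insert hbal hn]
  have s2 : ∑ v, ∑ a, X.pairWeight τ a v * (g a * g a) = Q := by
    rw [sum_comm, hQ]
    simp_rw [← sum_mul, sum_pairWeight_right hbal τ (by omega : _ ≤ n)]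
  rw [s1, s2] at hsum
  -- By balance, the sum over `v` is `(1 - t)Q - (1 - t)²Q ≤ (1 - c)(Q - (1 - t)²Q)`. Dividing by
  -- `tQ > 0` leaves `2c - 1 ≤ ct`.
  have hfin : (t * Q) * (2 * c - 1) ≤ (t * Q) * (c * t) := by nlinarith
  have := le_of_mul_le_mul_left hfin (mul_pos htpos hQ0)
  rw [gapMap, sub_le_iff_le_add, ← sub_le_iff_le_add', le_div_iff₀ hc0]
  linarith

end WeightedComplex

/-! ### Iterates of `f` -/

/-- The map `f` is increasing on positive numbers and sends `(q - 1)/q` to `(q - 2)/(q - 1)` for `q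
> 1`. So a start above `(n - 1)/n` keeps the iterates positive up to `i = n - 1`. -/
theorem lt_gapMap_iterate {n : ℕ} {c : ℝ} (hc : ((n : ℝ) - 1) / n < c) (i : ℕ) (hi : i < n) :
    ((n : ℝ) - 1 - i) / (n - i) < gapMap^[i] c := by
  induction i with
  | zero => simpa using hc
  | succ i ih =>
    have hlt := ih (by omega)
    have h1 : (i : ℝ) + 1 < n := by exact_mod_cast hi
    have h2 : (0 : ℝ) < n - 1 - i := by linarith
    have h3 : (0 : ℝ) < n - i := by linarith
    have h4 := div_pos h2 h3
    rw [Function.iterate_succ_apply', gapMap]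
    have h5 := one_div_lt_one_div_of_lt h4 hlt
    have h6 : ((n : ℝ) - 1 - (i + 1 : ℕ)) / (n - (i + 1 : ℕ)) =
        2 - 1 / (((n : ℝ) - 1 - i) / (n - i)) := by
      have : (n : ℝ) - (i + 1) ≠ 0 := by linarith
      push_cast
      field_simp
      ring
    rw [h6]
    linarith

theorem gapMap_iterate_pos {n : ℕ} {c : ℝ} (hc : ((n : ℝ) - 1) / n < c) (i : ℕ) (hi : i < n) :
    0 < gapMap^[i] c := by
  have h1 : (i : ℝ) + 1 ≤ n := by exact_mod_cast hi
  exact (div_nonneg (by linarith) (by linarith)).trans_lt (lt_gapMap_iterate hc i hi)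

theorem gapMap_iterate_le_one {n : ℕ} {c : ℝ} (hc : ((n : ℝ) - 1) / n < c) (hc1 : c ≤ 1) (i : ℕ)
    (hi : i < n) : gapMap^[i] c ≤ 1 := by
  induction i with
  | zero => simpa using hc1
  | succ i ih =>
    rw [Function.iterate_succ_apply', gapMap]
    have := one_le_one_div (gapMap_iterate_pos hc i (by omega)) (ih (by omega))
    linarith

theorem one_lt_gapMap_iterate {c : ℝ} (hc : 1 < c) (i : ℕ) : 1 < gapMap^[i] c := by
  induction i with
  | zero => simpa using hc
  | succ i ih =>
    rw [Function.iterate_succ_apply', gapMap]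
    have := (div_lt_one (by linarith)).mpr ih
    linarith

namespace WeightedComplex

open Finset

variable {V : Type*} [Fintype V] [DecidableEq V] {X : WeightedComplex V}

/-- Induction on the codimension: the gap in links of simplices with one more vertex descends by one
application of `f`. -/
theorem hasGap_iterate {n : ℕ} (hbal : X.IsBalanced n) (hconn : X.LinksConnected n) {c : ℝ}
    (hc : ((n : ℝ) - 1) / n < c)
    (hspec : ∀ (τ : Finset V) (hτ : τ ∈ X.faces), τ.card + 1 = n →
      spectrum ℝ ((X.link τ hτ).upperLaplacian 0) \ {0} ⊆ Set.Icc c 2)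
    (i : ℕ) (τ : Finset V) (hτ : τ ∈ X.faces) (hi : τ.card + 1 + i = n) :
    X.HasGap τ (gapMap^[i] c) := by
  induction i generalizing τ with
  | zero =>
    exact hasGap_of_spectrum hbal hτ (by omega) (hconn τ hτ (by omega))
      fun t ht ht0 => (hspec τ hτ (by omega) ⟨ht, ht0⟩).1
  | succ i ih =>
    refine hasGap_of_spectrum hbal hτ (by omega) (hconn τ hτ (by omega)) fun t ht ht0 => ?_
    rw [Function.iterate_succ_apply']
    refine le_of_mem_spectrum_link hbal hτ (by omega) (gapMap_iterate_pos hc i (by omega)) ?_ ht ht0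
    intro v hv hvf
    exact ih _ hvf (by rw [card_insert_of_notMem hv]; omega)

end WeightedComplex

/-! ### The degenerate case and the assembly of the norm bound -/

namespace WeightedComplex

open Finset

variable {V : Type*} [Fintype V] [DecidableEq V] {X : WeightedComplex V}

/-- A gap above `1` leaves only functions of the colour, so each colour has at most one vertex, and
an n-simplex, which uses every colour, is unique. -/
theorem IsColoring.card_filter_faces_le_one {n : ℕ} {col : V → Fin (n + 1)} (h : X.IsColoring col)
    (hbal : X.IsBalanced n) (hn : 0 < n) {c : ℝ} (hc : 1 < c) (hgap : X.HasGap ∅ c) :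
    (X.faces.filter (fun σ => σ.card = n + 1)).card ≤ 1 := by
  have hw := h.partiteWeights hbal X.empty_mem (by simpa using hn)
  have hinj : ∀ u v, {u} ∈ X.faces → {v} ∈ X.faces → col u = col v → u = v := by
    intro u v hu hv huv
    by_contra hne
    have hwu : X.linkWeight ∅ u ≠ 0 := linkWeight_ne_zero.mpr ⟨notMem_empty _, hu⟩
    have hwv : X.linkWeight ∅ v ≠ 0 := linkWeight_ne_zero.mpr ⟨notMem_empty _, hv⟩
    -- Two point masses normalised by weight, with opposite signs: they cancel within the common
    -- colour of `u` and `v`, yet `r u ≠ 0`.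
    let r : V → ℝ := Pi.single u (X.linkWeight ∅ u)⁻¹ - Pi.single v (X.linkWeight ∅ v)⁻¹
    have hr : ∀ x, X.linkWeight ∅ x * r x = (if u = x then 1 else 0) - if v = x then 1 else 0 := by
      intro x
      simp only [r, Pi.sub_apply, Pi.single_apply]
      by_cases h1 : u = x
      · subst h1
        simp [Ne.symm hne, hne, mul_inv_cancel₀ hwu]
      · by_cases h2 : v = x
        · subst h2
          simp [Ne.symm hne, hne, mul_inv_cancel₀ hwv]
        · simp [h1, h2, Ne.symm h1, Ne.symm h2]
    have h0 := hw.eq_zero_of_gap hc hgap r (fun j _ => by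
      have : ∀ x, (if col x = j then X.linkWeight ∅ x * r x else 0) =
          (if u = x then (if col u = j then 1 else 0) else 0) -
            if v = x then (if col u = j then 1 else 0) else 0 := by
        intro x
        rw [hr]
        by_cases h1 : u = x
        · subst h1
          simp [Ne.symm hne]
        · by_cases h2 : v = x
          · subst h2
            simp only [if_neg h1, if_true, huv]
            split_ifs <;> simp
          · simp [h1, h2]
      simp_rw [this]
      rw [sum_sub_distrib, sum_ite_eq, sum_ite_eq]
      simp) u
    have h1 := hr u
    rw [sq, ← mul_assoc, h1] at h0
    have h2 : r u = 0 := by simpa [Ne.symm hne] using h0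
    rw [h2] at h1
    simp [Ne.symm hne] at h1
  rw [card_le_one]
  intro σ hσ ρ hρ
  rw [mem_filter] at hσ hρ
  have hsub : σ ⊆ ρ := by
    intro v hv
    have himg : ρ.image col = univ := by
      rw [← card_eq_iff_eq_univ, card_image_of_injOn (h.injOn hρ.1), hρ.2, Fintype.card_fin]
    obtain ⟨u, hu, huv⟩ := mem_image.mp (himg ▸ mem_univ (col v))
    rw [← hinj u v (X.down_closed _ hρ.1 _ (by simpa using hu))
      (X.down_closed _ hσ.1 _ (by simpa using hv)) huv]
    exact hu
  exact eq_of_subset_of_card_le hsub (by rw [hσ.2, hρ.2])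

open Classical in
-- The local inequality in the link of `t`, with `N = n - k`, written for tuples so that it can be
-- summed. If `t` is not an ordered simplex every term is zero.
theorem IsColoring.abs_tuple_form_le {n k : ℕ} {col : V → Fin (n + 1)} (h : X.IsColoring col)
    (hbal : X.IsBalanced n) (hk : k < n) {c θ : ℝ} (hc : c ≤ 1)
    (hθ : θ = (2 + ((n : ℝ) - k - 1) * (1 - c)) / 2)
    (hgap : ∀ τ ∈ X.faces, τ.card = k → X.HasGap τ c) (t : Fin k → V) (g : V → ℝ) :
    |∑ v, X.tupleWeight (Fin.cons v t : Fin (k + 1) → V) * (g v * g v) -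
        (if Function.Injective t then
          ∑ u, ∑ v, X.pairWeight (univ.image t) u v * (g u * g v) else 0)
      + ((n : ℝ) + 1 - k) / (n - k) *
        ((∑ v, X.tupleWeight (Fin.cons v t : Fin (k + 1) → V) * (1 * g v)) ^ 2 / X.tupleWeight t)
      - θ * ∑ v, X.tupleWeight (Fin.cons v t : Fin (k + 1) → V) * (g v * g v)
      - (((n : ℝ) + 1 - k) ^ 2 / (n - k) - ((n : ℝ) + 1 - k) * θ) *
        ∑ j, (∑ v, X.tupleWeight (Fin.cons v t : Fin (k + 1) → V) *
          ((if col v = j then 1 else 0) * g v)) ^ 2 / X.tupleWeight t| ≤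
      ((n : ℝ) + 1 - k) * ((1 - c) / 2) *
        ∑ v, X.tupleWeight (Fin.cons v t : Fin (k + 1) → V) * (g v * g v) := by
  by_cases ht : X.tupleWeight t = 0
  · have h1 : ∀ v, X.tupleWeight (Fin.cons v t : Fin (k + 1) → V) = 0 := fun v => by
      by_contra h0
      exact tupleWeight_cons_ne_zero h0 ht
    have h2 : (if Function.Injective t then
        ∑ u, ∑ v, X.pairWeight (univ.image t) u v * (g u * g v) else 0) = 0 := by
      split_ifs with hi
      · refine sum_eq_zero fun u _ => sum_eq_zero fun v _ => ?_
        have := h1 v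
        rw [tupleWeight_cons, if_pos hi] at this
        rw [pairWeight_eq_zero_of_linkWeight this, zero_mul]
      · rfl
    simp [h1, h2]
  · obtain ⟨hi, hf⟩ := tupleWeight_ne_zero.mp ht
    have hcard : (univ.image t).card = k := by
      rw [card_image_of_injective _ hi, card_univ, Fintype.card_fin]
    have hw := h.partiteWeights hbal hf (by omega)
    have hN : ((n - (univ.image t).card : ℕ) : ℝ) = (n : ℝ) - k := by
      rw [hcard, Nat.cast_sub hk.le]
    have key := hw.abs_form_le (θ := θ) hc (by rw [hN]; exact hθ) (hgap _ hf hcard) g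
    rw [hN] at key
    have hm : X.tupleWeight t = X.weight (univ.image t) := by
      rw [tupleWeight, if_pos hi, faceWeight, if_pos hf]
    -- No vertex of the link has a colour of `t`, so those colours add nothing.
    have hj : ∑ j, (∑ v, X.linkWeight (univ.image t) v * ((if col v = j then 1 else 0) * g v)) ^ 2 /
        X.weight (univ.image t) = ∑ j ∈ univ \ (univ.image t).image col,
        (∑ v, if col v = j then X.linkWeight (univ.image t) v * g v else 0) ^ 2 /
          X.weight (univ.image t) := by
      rw [← sum_subset (sdiff_subset (s := univ) (t := (univ.image t).image col))]
      · refine sum_congr rfl fun j _ => ?_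
        congr 2
        exact sum_congr rfl fun v _ => by split_ifs <;> simp
      · intro j _ hj
        have : ∑ v, X.linkWeight (univ.image t) v * ((if col v = j then 1 else 0) * g v) = 0 := by
          refine sum_eq_zero fun v _ => ?_
          by_cases hv : X.linkWeight (univ.image t) v = 0
          · rw [hv, zero_mul]
          · rw [if_neg fun hvj : col v = j => hj (hvj ▸ hw.col_mem v hv), zero_mul, mul_zero]
        rw [this]
        simp
    simp_rw [tupleWeight_cons, if_pos hi, hm]
    rw [hj]
    have e : (n : ℝ) - k + 1 = n + 1 - k := by ring
    rw [e] at key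
    simp_rw [sq (g _)] at key
    simpa only [one_mul] using key

open Classical in
theorem inner_upperLaplacian {n k : ℕ} (hbal : X.IsBalanced n) (hk : k < n)
    (φ : X.Cochain (k + 1)) :
    inner ℝ (X.upperLaplacian k φ) φ = inner ℝ φ φ -
      (∑ t : Fin k → V, if Function.Injective t then
        ∑ u, ∑ v, X.pairWeight (univ.image t) u v *
          (φ.onTuples (Fin.cons u t : Fin (k + 1) → V) *
            φ.onTuples (Fin.cons v t : Fin (k + 1) → V)) else 0) / k.factorial := by
  rw [upperLaplacian, LinearMap.comp_apply, LinearMap.adjoint_inner_left]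
  refine inner_diff_diff (fun t => ?_) φ φ
  simp_rw [tupleWeight_cons, tupleWeight]
  split_ifs with ht
  · apply sum_linkWeight hbal
    rw [card_image_of_injective _ ht, card_univ, Fintype.card_fin]
    omega
  · simp

end WeightedComplex

open WeightedComplex in
theorem corollary6p4 {V : Type*} [Fintype V] [DecidableEq V] (n : ℕ) (X : WeightedComplex V)
    (hpure : X.IsPure n) (hbal : X.IsBalanced n)
    (S : Fin (n + 1) → Finset V) (hpart : X.IsPartite n S)
    (hconn : X.LinksConnected n)
    (lam : ℝ) (hlam : ((n : ℝ) - 1) / n < lam)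
    (hspec : ∀ (τ : Finset V) (hτ : τ ∈ X.faces), τ.card + 1 = n →
      spectrum ℝ ((X.link τ hτ).upperLaplacian 0) \ {0} ⊆ Set.Icc lam 2)
    (hnontriv : 1 < (X.faces.filter (fun σ => σ.card = n + 1)).card ∨ lam ≤ 1)
    (k : ℕ) (hk : k < n) (μ θ : ℝ) (hμ : μ = gapMap^[n - 1 - k] lam)
    (hθ : θ = (2 + ((n : ℝ) - k - 1) * (1 - μ)) / 2) :
    operatorNorm
      (X.upperLaplacian k
        + (((n : ℝ) + 1 - k) / ((n : ℝ) - k)) • X.lowerLaplacian k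
        + ((k : ℝ) - ((k : ℝ) + 1) * θ) • (1 : Module.End ℝ (X.Cochain (k + 1)))
        - (((n : ℝ) + 1 - k) ^ 2 / ((n : ℝ) - k) - ((n : ℝ) + 1 - k) * θ) •
            ∑ j : Fin (n + 1), X.sideLaplacian (S j) k)
      ≤ ((k : ℝ) + 1) * ((n : ℝ) + 1 - k) * ((1 - μ) / 2) := by
  classical
  obtain ⟨col, hcol, hS⟩ := hpart.exists_coloring
  have hgap := hasGap_iterate hbal hconn hlam hspec
  have hlam1 : lam ≤ 1 := by
    -- If `lam > 1`, all iterates exceed `1`, in particular the gap of `X` itself, the link of `∅`.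
    rcases hnontriv with h1 | h1
    · by_contra hgt
      have := hcol.card_filter_faces_le_one hbal (by omega)
        (one_lt_gapMap_iterate (not_le.mp hgt) (n - 1))
        (hgap (n - 1) ∅ X.empty_mem (by rw [Finset.card_empty]; omega))
      omega
    · exact h1
  have hμ1 : μ ≤ 1 := hμ ▸ gapMap_iterate_le_one hlam hlam1 _ (by omega)
  have hkn : (k : ℝ) + 1 ≤ n := by exact_mod_cast hk
  have hloc := hcol.abs_tuple_form_le hbal hk hμ1 hθ fun τ hτ hcard =>
    hμ ▸ hgap (n - 1 - k) τ hτ (by omega)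
  refine operatorNorm_le_of_abs_inner_le ?_ ?_ fun φ => ?_
  · have h1 : LinearMap.IsSymmetric (X.upperLaplacian k) :=
      LinearMap.isSymmetric_adjoint_comp_self _
    have h2 : LinearMap.IsSymmetric (X.lowerLaplacian k) :=
      LinearMap.isSymmetric_self_comp_adjoint _
    have h3 : LinearMap.IsSymmetric (∑ j : Fin (n + 1), X.sideLaplacian (S j) k) :=
      LinearMap.isSymmetric_sum _ fun j _ => LinearMap.isSymmetric_self_comp_adjoint _
    exact ((h1.add (h2.smul (conj_trivial _))).add
      (LinearMap.IsSymmetric.one.smul (conj_trivial _))).sub (h3.smul (conj_trivial _))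
  · have : 0 ≤ (1 - μ) / 2 := by linarith
    have : (0 : ℝ) ≤ (n : ℝ) + 1 - k := by linarith
    positivity
  · let g : (Fin k → V) → V → ℝ := fun t v => φ.onTuples (Fin.cons v t : Fin (k + 1) → V)
    have hup := inner_upperLaplacian hbal hk φ
    have hlow : inner ℝ (X.lowerLaplacian k φ) φ = _ := (isWeightedDiff_diff k).inner_comp_adjoint φ
    have hside : ∀ j, inner ℝ (X.sideLaplacian (S j) k φ) φ = _ := fun j =>
      (isWeightedDiff_sideDiff (fun v hv => hS v j hv) k).inner_comp_adjoint φ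
    have hnorm := Cochain.inner_eq φ φ
    rw [sum_tuple_cons, Finset.sum_comm, Nat.factorial_succ] at hnorm
    have hsum := (Finset.abs_sum_le_sum_abs _ _).trans
      (Finset.sum_le_sum fun t (_ : t ∈ Finset.univ) => hloc t (g t))
    rw [Finset.sum_sub_distrib, Finset.sum_sub_distrib, Finset.sum_add_distrib,
      Finset.sum_sub_distrib, ← Finset.mul_sum, ← Finset.mul_sum, ← Finset.mul_sum,
      ← Finset.mul_sum, Finset.sum_comm (s := Finset.univ) (t := (Finset.univ : Finset (Fin (n + 1))))]
      at hsum
    rw [LinearMap.sub_apply, LinearMap.add_apply, LinearMap.add_apply, LinearMap.smul_apply,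
      LinearMap.smul_apply, LinearMap.smul_apply, LinearMap.sum_apply, Module.End.one_apply,
      inner_sub_left, inner_add_left, inner_add_left, real_inner_smul_left, real_inner_smul_left,
      real_inner_smul_left, sum_inner, hup, hlow, Finset.sum_congr rfl fun j _ => hside j,
      ← Finset.sum_div, hnorm]
    simp only [g] at hsum
    set A := ∑ t : Fin k → V, ∑ v, X.tupleWeight (Fin.cons v t : Fin (k + 1) → V) *
      (φ.onTuples (Fin.cons v t : Fin (k + 1) → V) * φ.onTuples (Fin.cons v t : Fin (k + 1) → V))
    have hF : (0 : ℝ) < k.factorial := by exact_mod_cast k.factorial_pos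
    have hk1 : (0 : ℝ) < (k : ℝ) + 1 := by positivity
    push_cast
    have hdiv := div_le_div_of_nonneg_right hsum hF.le
    nth_rw 1 [← abs_of_pos hF] at hdiv
    rw [← abs_div] at hdiv
    -- Both sides are compared through `A / k! = (k + 1)⟨φ, φ⟩`: this turns `⟨φ, φ⟩ + k⟨φ, φ⟩` into
    -- the local sums of `Q`, and is the source of the factor `k + 1` in the bound.
    refine le_trans (le_of_eq (congrArg abs ?_)) (hdiv.trans (le_of_eq ?_))
    · generalize ((n : ℝ) + 1 - k) / (n - k) = α
      generalize ((n : ℝ) + 1 - k) ^ 2 / (n - k) - ((n : ℝ) + 1 - k) * θ = γ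
      field_simp
      ring
    · field_simp
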